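/- **Theorem (oracle inequality).** Let $\mathbb H=L^2([0,1])$ with its usual scalar product $\langle\cdot,\cdot\rangle$ and norm $\|\cdot\|$, and write $b\otimes a$ for the operator $f\mapsto\langle a,f\rangle b$. Let $S$ be the integral operator $Sf(t)=\int_0^1\mathcal S(s,t)f(s)\,ds$ with kernel $\mathcal S\in L^2([0,1]^2)$, and let $Y_i=SX_i+\varepsilon_i$, $i=1,\dots,n$, where $(X_i,\varepsilon_i)$ are independent copies of a pair $(X,\varepsilon)$ of independent, centered random elements of $\mathbb H$ with $\mathbb E\|X\|^2<\infty$ and $\sigma_\varepsilon^2=\mathbb E\|\varepsilon\|^2<\infty$. Assume that $\tau_p=\mathbb E\|\varepsilon\|^p<\infty$ for some $p>6$. Put $\Gamma_n=\frac1n\sum_i X_i\otimes X_i$ and $\Delta_n=\frac1n\sum_i Y_i\otimes X_i$. Let $(\widehat\varphi_j)_{j\ge1}$ be an orthonormal (Hilbert) basis of $\mathbb H$, chosen as a measurable function of $(X_1,\dots,X_n)$, which consists of eigenvectors of $\Gamma_n$ with eigenvalues $\widehat\lambda_1\ge\widehat\lambda_2\ge\cdots\ge0$. For $m\ge1$ let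 $\Gamma_{n,m}^\dagger=\sum_{j\le m,\ \widehat\lambda_j>0}\widehat\lambda_j^{-1}\,\widehat\varphi_j\otimes\widehat\varphi_j$ and $\widehat S_{m,\infty}=\Delta_n\Gamma_{n,m}^\dagger$. Let $\widehat\Pi^{op}_{m,\infty}$ be the orthogonal projection, in the Hilbert space of Hilbert–Schmidt operators on $\mathbb H$ (identified with their kernels in $L^2([0,1]^2)$), onto the closure of $\mathrm{span}\{\widehat\varphi_k\otimes\widehat\varphi_j:\ 1\le j\le m,\ k\ge1\}$. For an operator $T$ write $\gamma_n(T)=\frac1n\sum_i\|Y_i-TX_i\|^2$ and $\|T\|_n^2=\frac1n\sum_i\|TX_i\|^2$. Let $\delta>0$, $\mathrm{pen}(m)=8(1+\delta)\sigma_\varepsilon^2\,m/n$, $\mathcal M_n=\{1,\dots,N_n\}$ with $N_n\ge1$ and $N_n\ln^2(n)\le n$, and let $\widehat m_1$ be a (measurable) minimizer of $\gamma_n(\widehat S_{m_1,\infty})+\mathrm{pen}(m_1)$ over $m_1\in\mathcal M_n$. Then for every $\zeta>0$ the random variables $\|S-\widehat S_{\widehat m_1,\infty}\|_n^2$ and $\|S-\widehat\Pi^{op}_{m_1,\infty}S\|_n^2$,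 $m_1\in\mathcal M_n$, are integrable, and $$\mathbb E\|S-\widehat S_{\widehat m_1,\infty}\|_n^2\le(1+\zeta)\inf_{m_1\in\mathcal M_n}\Big\{\mathbb E\|S-\widehat\Pi^{op}_{m_1,\infty}S\|_n^2+c(\zeta)\,\mathrm{pen}(m_1)\Big\}+\frac{C'}{n},\qquad c(\zeta)=\frac{2+\zeta}{1+\zeta},$$ where $C'>0$ depends only on $p$, $\delta$, $\zeta$, $\sigma_\varepsilon^2$ and $\tau_p$; in particular it does not depend on $n$, $N_n$, $m_1$, $S$ or the law of $X$. -/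

import Mathlib

open MeasureTheory ProbabilityTheory
open scoped unitInterval RealInnerProductSpace

noncomputable section

namespace FunLin

/-! ### The functional space `L²([0,1])` and integral operators with a kernel in `L²([0,1]²)` -/

/-- The real Hilbert space `H = L²([0,1])`. -/
abbrev H : Type := Lp ℝ 2 (volume : Measure I)

/-- The real Hilbert space `L²([0,1]²)` of kernels. -/
abbrev HKer : Type := Lp ℝ 2 (volume : Measure (I × I))

instance instMeasurableSpaceH : MeasurableSpace H := borel H

instance instBorelSpaceH : BorelSpace H := ⟨rfl⟩

theorem kernel_memLp_prod (K : HKer) :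
    MemLp (K : I × I → ℝ) 2 ((volume : Measure I).prod (volume : Measure I)) :=
  Lp.memLp K

theorem kernel_sq_integrable (K : HKer) :
    Integrable (fun p : I × I => K p ^ 2) ((volume : Measure I).prod (volume : Measure I)) :=
  (kernel_memLp_prod K).integrable_sq

theorem kernel_section_memLp (K : HKer) :
    ∀ᵐ t : I, MemLp (fun s : I => K (s, t)) 2 volume := by
  have h1 : ∀ᵐ t : I, AEStronglyMeasurable (fun s : I => K (s, t)) volume := by
    have h := ((kernel_memLp_prod K).aestronglyMeasurable.prod_swap).prodMk_left
    simpa using h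
  have h2 := (kernel_sq_integrable K).prod_left_ae
  filter_upwards [h1, h2] with t ht1 ht2
  exact (memLp_two_iff_integrable_sq ht1).2 ht2

theorem kernel_section_bound (K : HKer) (f : H) :
    ∀ᵐ t : I, Integrable (fun s : I => K (s, t) * f s) volume ∧
      (∫ s : I, K (s, t) * f s) ^ 2 ≤ ‖f‖ ^ 2 * ∫ s : I, K (s, t) ^ 2 := by
  filter_upwards [kernel_section_memLp K] with t ht
  have hi : Integrable (fun s : I => K (s, t) * f s) volume := ht.integrable_mul (Lp.memLp f)
  refine ⟨hi, ?_⟩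
  set k : H := ht.toLp _ with hk
  have hkae : (k : I → ℝ) =ᵐ[volume] fun s => K (s, t) := ht.coeFn_toLp
  have e1 : ⟪k, f⟫ = ∫ s : I, K (s, t) * f s := by
    rw [L2.inner_def]
    refine integral_congr_ae ?_
    filter_upwards [hkae] with s hs
    simp [hs, mul_comm]
  have e2 : ‖k‖ ^ 2 = ∫ s : I, K (s, t) ^ 2 := by
    rw [← real_inner_self_eq_norm_sq, L2.inner_def]
    refine integral_congr_ae ?_
    filter_upwards [hkae] with s hs
    simp [hs, sq]
  rw [← e1, ← e2, ← mul_pow, mul_comm ‖f‖]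
  exact sq_le_sq' (neg_le_of_abs_le (abs_real_inner_le_norm k f)) (real_inner_le_norm k f)

theorem integralOp_aestronglyMeasurable (K : HKer) (f : H) :
    AEStronglyMeasurable (fun t : I => ∫ s : I, K (s, t) * f s) volume := by
  have h : AEStronglyMeasurable (fun p : I × I => K (p.2, p.1) * f p.2)
      ((volume : Measure I).prod (volume : Measure I)) := by
    refine AEStronglyMeasurable.mul ?_ ?_
    · exact (kernel_memLp_prod K).aestronglyMeasurable.prod_swap
    · exact (Lp.aestronglyMeasurable f).comp_snd
  exact h.integral_prod_right'

theorem integralOp_memLp (K : HKer) (f : H) :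
    MemLp (fun t : I => ∫ s : I, K (s, t) * f s) 2 volume := by
  have hm := integralOp_aestronglyMeasurable K f
  refine (memLp_two_iff_integrable_sq hm).2 ?_
  refine ((kernel_sq_integrable K).integral_prod_right.const_mul (‖f‖ ^ 2)).mono' (hm.pow 2) ?_
  filter_upwards [kernel_section_bound K f] with t ht
  rw [Real.norm_of_nonneg (sq_nonneg _)]
  exact ht.2

theorem kernel_norm_sq (K : HKer) : ‖K‖ ^ 2 = ∫ t : I, ∫ s : I, K (s, t) ^ 2 := by
  rw [← real_inner_self_eq_norm_sq, L2.inner_def]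
  have := integral_prod_symm _ (kernel_sq_integrable K)
  rw [← this]
  refine integral_congr_ae (Filter.Eventually.of_forall fun p => ?_)
  simp [sq]

/-- The integral operator `(T f)(t) = ∫₀¹ K(s,t) f(s) ds` with kernel `K ∈ L²([0,1]²)`, as a bounded
operator of `L²([0,1])`. These are exactly the Hilbert-Schmidt operators of `L²([0,1])`, and the
Hilbert-Schmidt norm of the operator is the `L²([0,1]²)` norm of its kernel. -/
def integralOp (K : HKer) : H →L[ℝ] H :=
  LinearMap.mkContinuous
    { toFun := fun f => (integralOp_memLp K f).toLp (fun t : I => ∫ s : I, K (s, t) * f s)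
      map_add' := by
        intro f g
        rw [← MemLp.toLp_add]
        refine (MemLp.toLp_eq_toLp_iff _ _).2 ?_
        filter_upwards [kernel_section_bound K f, kernel_section_bound K g] with t hf hg
        rw [Pi.add_apply, ← integral_add hf.1 hg.1]
        refine integral_congr_ae ?_
        filter_upwards [Lp.coeFn_add f g] with s hs
        rw [hs, Pi.add_apply, mul_add]
      map_smul' := by
        intro c f
        rw [RingHom.id_apply, ← MemLp.toLp_const_smul]
        refine (MemLp.toLp_eq_toLp_iff _ _).2 (Filter.Eventually.of_forall fun t => ?_)
        simp only [Pi.smul_apply, smul_eq_mul]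
        rw [← integral_const_mul]
        refine integral_congr_ae ?_
        filter_upwards [Lp.coeFn_smul c f] with s hs
        rw [hs, Pi.smul_apply, smul_eq_mul]
        ring }
    ‖K‖ (by
      intro f
      refine abs_le_of_sq_le_sq' ?_ (by positivity) |>.2
      simp only [LinearMap.coe_mk, AddHom.coe_mk]
      rw [← real_inner_self_eq_norm_sq, L2.inner_def, mul_pow, kernel_norm_sq, mul_comm,
        ← integral_const_mul]
      refine integral_mono_ae (L2.integrable_inner _ _)
        ((kernel_sq_integrable K).integral_prod_right.const_mul (‖f‖ ^ 2)) ?_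
      filter_upwards [kernel_section_bound K f, (integralOp_memLp K f).coeFn_toLp] with t ht h2
      have := ht.2
      simp only [h2]
      simpa [sq] using this)

theorem integralOp_apply_ae (K : HKer) (f : H) :
    (integralOp K f : I → ℝ) =ᵐ[volume] fun t => ∫ s : I, K (s, t) * f s :=
  (integralOp_memLp K f).coeFn_toLp

theorem tensorKer_memLp (b a : H) :
    MemLp (fun p : I × I => a p.1 * b p.2) 2 (volume : Measure (I × I)) := by
  have hm : AEStronglyMeasurable (fun p : I × I => a p.1 * b p.2)
      ((volume : Measure I).prod (volume : Measure I)) :=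
    (Lp.aestronglyMeasurable a).comp_fst.mul (Lp.aestronglyMeasurable b).comp_snd
  refine (memLp_two_iff_integrable_sq hm).2 ?_
  have := (Lp.memLp a).integrable_sq.mul_prod (Lp.memLp b).integrable_sq
  refine this.congr (Filter.Eventually.of_forall fun p => ?_)
  simp [mul_pow]

/-- The kernel `(s,t) ↦ a(s) b(t)` of the rank-one operator `b ⊗ a : f ↦ ⟨a, f⟩ b`. -/
def tensorKer (b a : H) : HKer := (tensorKer_memLp b a).toLp _

/-- The operator with kernel `tensorKer b a` is indeed `b ⊗ a : f ↦ ⟨a, f⟩ b`. -/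
theorem integralOp_tensorKer (b a : H) :
    integralOp (tensorKer b a) = InnerProductSpace.rankOne ℝ b a := by
  ext1 f
  refine Lp.ext ?_
  have hk : ∀ᵐ t : I, ∀ᵐ s : I, tensorKer b a (s, t) = a s * b t := by
    have h : ∀ᵐ p ∂((volume : Measure I).prod (volume : Measure I)),
        tensorKer b a p = a p.1 * b p.2 := (tensorKer_memLp b a).coeFn_toLp
    exact Measure.ae_ae_of_ae_prod (Measure.measurePreserving_swap.quasiMeasurePreserving.ae h)
  have hr : InnerProductSpace.rankOne ℝ b a f = ⟪a, f⟫ • b := by simp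
  rw [hr]
  filter_upwards [integralOp_apply_ae (tensorKer b a) f, hk, Lp.coeFn_smul ⟪a, f⟫ b]
    with t h1 h2 h3
  rw [h1, h3, Pi.smul_apply, smul_eq_mul, L2.inner_def, ← integral_mul_const]
  refine integral_congr_ae ?_
  filter_upwards [h2] with s hs
  rw [hs]
  simp
  ring

/-- The Hilbert-Schmidt norm `(∑ⱼ ‖T eⱼ‖²)^{1/2}` of an integral operator is the norm of its kernel,
so that `L²([0,1]²)` is the Hilbert space of Hilbert-Schmidt operators. -/
theorem hasSum_norm_sq_integralOp (K : HKer) (e : HilbertBasis ℕ ℝ H) :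
    HasSum (fun j => ‖integralOp K (e j)‖ ^ 2) (‖K‖ ^ 2) := by
  have hpt : ∀ᵐ t : I, HasSum (fun j => (integralOp K (e j) t) ^ 2) (∫ s : I, K (s, t) ^ 2) := by
    have hall : ∀ᵐ t : I, ∀ j, integralOp K (e j) t = ∫ s : I, K (s, t) * e j s :=
      ae_all_iff.2 fun j => integralOp_apply_ae K (e j)
    filter_upwards [hall, kernel_section_memLp K] with t h1 ht
    set k : H := ht.toLp _ with hk
    have hkae : (k : I → ℝ) =ᵐ[volume] fun s => K (s, t) := ht.coeFn_toLp
    have e1 : ∀ j, ⟪k, e j⟫ = ∫ s : I, K (s, t) * e j s := by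
      intro j
      rw [L2.inner_def]
      refine integral_congr_ae ?_
      filter_upwards [hkae] with s hs
      simp [hs, mul_comm]
    have e2 : ‖k‖ ^ 2 = ∫ s : I, K (s, t) ^ 2 := by
      rw [← real_inner_self_eq_norm_sq, L2.inner_def]
      refine integral_congr_ae ?_
      filter_upwards [hkae] with s hs
      simp [hs, sq]
    have := e.hasSum_inner_mul_inner k k
    rw [real_inner_self_eq_norm_sq, e2] at this
    refine this.congr_fun ?_
    intro j
    rw [h1 j, ← e1 j, sq, real_inner_comm k (e j)]
  have hn : ∀ j, ‖integralOp K (e j)‖ ^ 2 = ∫ t : I, (integralOp K (e j) t) ^ 2 := by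
    intro j
    rw [← real_inner_self_eq_norm_sq, L2.inner_def]
    simp [sq]
  have hint : ∀ j, Integrable (fun t : I => (integralOp K (e j) t) ^ 2) volume :=
    fun j => (Lp.memLp (integralOp K (e j))).integrable_sq
  simp_rw [hn]
  rw [kernel_norm_sq]
  exact hasSum_integral_of_dominated_convergence (fun j t => (integralOp K (e j) t) ^ 2)
    (fun j => (hint j).aestronglyMeasurable)
    (fun j => Filter.Eventually.of_forall fun t => by
      rw [Real.norm_of_nonneg (sq_nonneg _)])
    (hpt.mono fun t h => h.summable)
    ((kernel_sq_integrable K).integral_prod_right.congr (hpt.mono fun t h => h.tsum_eq.symm))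
    hpt

/-! ### Estimators computed from a sample `(x₁,y₁),…,(xₙ,yₙ)` -/

variable {n : ℕ}

/-- Empirical covariance operator `Γₙ = n⁻¹ ∑ᵢ xᵢ ⊗ xᵢ`. -/
def empCov (x : Fin n → H) : H →L[ℝ] H :=
  (n : ℝ)⁻¹ • ∑ i, InnerProductSpace.rankOne ℝ (x i) (x i)

/-- Empirical cross-covariance operator `Δₙ = n⁻¹ ∑ᵢ yᵢ ⊗ xᵢ`. -/
def empCrossCov (x y : Fin n → H) : H →L[ℝ] H :=
  (n : ℝ)⁻¹ • ∑ i, InnerProductSpace.rankOne ℝ (y i) (x i)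

/-- The eigenvalue of `Γₙ` attached to the (unit) eigenvector `φ j`. Indices start at `0`. -/
def empEigenvalue (x : Fin n → H) (φ : HilbertBasis ℕ ℝ H) (j : ℕ) : ℝ :=
  ⟪φ j, empCov x (φ j)⟫

/-- `φ` is an empirical PCA basis: a Hilbert basis of eigenvectors of `Γₙ`, sorted so that the
eigenvalues do not increase. -/
structure IsEmpPCABasis (x : Fin n → H) (φ : HilbertBasis ℕ ℝ H) : Prop where
  eigen : ∀ j, empCov x (φ j) = empEigenvalue x φ j • φ j
  sorted : Antitone (empEigenvalue x φ)

/-- The truncated pseudo-inverse `∑_{j ≤ m} λ̂ⱼ⁻¹ φ̂ⱼ ⊗ φ̂ⱼ` of `Γₙ`. The terms with `λ̂ⱼ = 0` vanish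
(`0⁻¹ = 0`), so that for `m` larger than the rank of `Γₙ` the sum stops at that rank. -/
def empPinv (x : Fin n → H) (φ : HilbertBasis ℕ ℝ H) (m : ℕ) : H →L[ℝ] H :=
  ∑ j ∈ Finset.range m, (empEigenvalue x φ j)⁻¹ • InnerProductSpace.rankOne ℝ (φ j) (φ j)

/-- The estimator `Ŝ_{m,∞} = Δₙ Γ†_{n,m}`. -/
def slopeEst (x y : Fin n → H) (φ : HilbertBasis ℕ ℝ H) (m : ℕ) : H →L[ℝ] H :=
  empCrossCov x y ∘L empPinv x φ m

/-- The least-squares contrast `γₙ(T) = n⁻¹ ∑ᵢ ‖yᵢ - T xᵢ‖²`. -/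
def contrast (x y : Fin n → H) (T : H →L[ℝ] H) : ℝ :=
  (n : ℝ)⁻¹ * ∑ i, ‖y i - T (x i)‖ ^ 2

/-- The squared empirical norm `‖T‖ₙ² = n⁻¹ ∑ᵢ ‖T xᵢ‖²`. -/
def empNormSq (x : Fin n → H) (T : H →L[ℝ] H) : ℝ :=
  (n : ℝ)⁻¹ * ∑ i, ‖T (x i)‖ ^ 2

/-- The penalty `pen(m) = 8 (1 + δ) σ² m / n`, where `σsq` stands for `σ²`. -/
def pen (n : ℕ) (δ σsq : ℝ) (m : ℕ) : ℝ :=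
  8 * (1 + δ) * σsq * m / n

/-- `m` minimizes the penalized contrast `γₙ(Ŝ_{m,∞}) + pen(m)` over `{1, …, N}`. -/
def IsSelected (x y : Fin n → H) (φ : HilbertBasis ℕ ℝ H) (δ σsq : ℝ) (N m : ℕ) : Prop :=
  m ∈ Set.Icc 1 N ∧ ∀ m' ∈ Set.Icc 1 N,
    contrast x y (slopeEst x y φ m) + pen n δ σsq m ≤
      contrast x y (slopeEst x y φ m') + pen n δ σsq m'

/-- The model `V_{m,∞} = span {φₖ ⊗ φⱼ : j ≤ m, k ≥ 1}`, as a space of kernels. -/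
def modelSpace (φ : HilbertBasis ℕ ℝ H) (m : ℕ) : Submodule ℝ HKer :=
  Submodule.span ℝ {K | ∃ j < m, ∃ k : ℕ, K = tensorKer (φ k) (φ j)}

/-- The Hilbert-Schmidt-orthogonal projection onto the closure of `V_{m,∞}` of the integral operator
with kernel `K`. -/
def projOp (φ : HilbertBasis ℕ ℝ H) (m : ℕ) (K : HKer) : H →L[ℝ] H :=
  integralOp ((modelSpace φ m).topologicalClosure.starProjection K)

/-! ### The statistical model -/

/-- `(X₁,ε₁),…,(Xₙ,εₙ)` are independent copies of a pair `(X,ε)` of independent centered random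
elements of `L²([0,1])` with `E‖X‖² < ∞` and `E‖ε‖² = σsq < ∞`. -/
structure IsDesignNoise {Ω : Type*} [MeasurableSpace Ω] (P : Measure Ω)
    (X ε : Fin n → Ω → H) (σsq : ℝ) : Prop where
  measurable_X : ∀ i, Measurable (X i)
  measurable_noise : ∀ i, Measurable (ε i)
  iIndep : iIndepFun (fun i ω => (X i ω, ε i ω)) P
  identDistrib : ∀ i j, IdentDistrib (fun ω => (X i ω, ε i ω)) (fun ω => (X j ω, ε j ω)) P P
  indep : ∀ i, IndepFun (X i) (ε i) P
  memLp_X : ∀ i, MemLp (X i) 2 P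
  memLp_noise : ∀ i, MemLp (ε i) 2 P
  mean_X : ∀ i, ∫ ω, X i ω ∂P = 0
  mean_noise : ∀ i, ∫ ω, ε i ω ∂P = 0
  variance_noise : ∀ i, ∫ ω, ‖ε i ω‖ ^ 2 ∂P = σsq

/-- The response `Yᵢ = S Xᵢ + εᵢ`, where `S` is the integral operator with kernel `K`. -/
def response {Ω : Type*} (K : HKer) (X ε : Fin n → Ω → H) (i : Fin n) (ω : Ω) : H :=
  integralOp K (X i ω) + ε i ω

end FunLin

end

/-!
On the sample the problem is a regression with fixed design. If `aⱼ = (⟪φ̂ⱼ, Xᵢ⟫)ᵢ` denote the score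
vectors, the eigenvalue equation says that they are orthogonal in `ℝⁿ`, with squared norms `n λ̂ⱼ`.
Let `Aₘ` be the orthogonal projection of `ℝⁿ` on the span of `aⱼ`, `j ≤ m` (`hatMatrix`). Then
`(Ŝₘ Xᵢ)ᵢ = Aₘ Y` (`slopeEst_apply_eq`) and `(Π̂ₘ S Xᵢ)ᵢ = Aₘ F` with `F = (S Xᵢ)ᵢ`
(`IsEmpPCABasis.projOp_apply_eq`), the matrices acting on `n`-tuples of vectors. The selected
estimator is thus a penalized least-squares estimator over nested projections
(`IsEmpPCABasis.isNestedProjection`).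

Expanding squares around the selected projection `A_m̂` instead of bounding the cross term by the
Cauchy-Schwarz inequality on the whole model gives, for `0 < η < 1` and every `m`,
`(1 - η) ‖F - A_m̂ Y‖² ≤ (1 + η) ‖F - Aₘ F‖² + n pen(m) - n pen(m̂) + 2 ‖A_m̂ ε‖² + Z_m̂ / η`,
where `Z_l = ⟨ε, u_l⟩² / ‖u_l‖²` with `u_l = A_l F - Aₘ F`
(`penalized_projection_inequality`). The linear term `Z_l` does not grow with the dimension, so `η`,
and with it the factor `1 + ζ`, may be taken as small as needed without any change in the penalty.

It remains to see that the noise terms exceed their shares of `n pen(m̂)` only by an amount of bounded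
mean, uniformly in the design. For `l = m̂` unknown the excesses are summed over all `l`. The sixth
moment of a linear form is bounded (`IsNoise.integral_sum_inner_pow_six_le`), which makes the excess of
`Z_l` of order `l⁻²`. As `‖A_l ε‖²` increases with `l`, dyadic `l` suffice for it; the factor `8` in
the penalty leaves room for the doubling. The centered quadratic form is a martingale in
the noise vectors, with third absolute moment of order `l ^ (3 / 2)`
(`IsNoise.integral_abs_quadForm_sub_pow_three_le`), which makes the excess of order `l ^ (-1 / 2)`,
summable over dyadic `l`. Both moments only involve `E‖ε‖⁶`. Finally the whole design is independent
of the whole noise (`IsDesignNoise.indepFun_design_noise`), so that the bound for a fixed design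
carries over to a random one.
-/

namespace FunLin

/-! ### Rank-one kernels and the Hilbert-Schmidt projection -/

instance instSecondCountableTopologyH : SecondCountableTopology H :=
  haveI : Fact ((2 : ENNReal) ≠ ⊤) := ⟨by simp⟩
  inferInstance

/-- Rank-one kernels represent matrix coefficients of integral operators. -/
theorem inner_tensorKer (b a : H) (K : HKer) : ⟪tensorKer b a, K⟫ = ⟪b, integralOp K a⟫ := by
  have hint : Integrable (fun q : I × I => K q * (a q.1 * b q.2))
      ((volume : Measure I).prod (volume : Measure I)) :=
    (Lp.memLp K).integrable_mul (tensorKer_memLp b a)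
  have e1 : ⟪tensorKer b a, K⟫ =
      ∫ q : I × I, K q * (a q.1 * b q.2) ∂((volume : Measure I).prod (volume : Measure I)) := by
    rw [L2.inner_def]
    refine integral_congr_ae ?_
    filter_upwards [(tensorKer_memLp b a).coeFn_toLp] with q hq
    simp [tensorKer, hq]
  rw [e1, integral_prod_symm _ hint, L2.inner_def]
  refine integral_congr_ae ?_
  filter_upwards [integralOp_apply_ae K a] with t ht
  simp only [ht, RCLike.inner_apply, conj_trivial, ← integral_mul_const]
  refine integral_congr_ae (Filter.Eventually.of_forall fun s => ?_)
  simp only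
  ring

theorem integralOp_sub_apply (K L : HKer) (f : H) :
    integralOp (K - L) f = integralOp K f - integralOp L f := by
  refine ext_inner_left ℝ fun b => ?_
  rw [inner_sub_right, ← inner_tensorKer, ← inner_tensorKer, ← inner_tensorKer, inner_sub_right]

theorem integralOp_sum_apply (K : ℕ → HKer) (s : Finset ℕ) (f : H) :
    integralOp (∑ j ∈ s, K j) f = ∑ j ∈ s, integralOp (K j) f := by
  refine ext_inner_left ℝ fun b => ?_
  simp_rw [inner_sum, ← inner_tensorKer, inner_sum]

/-- An operator is orthogonal to the model exactly when it vanishes on the first `m` vectors. -/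
theorem mem_orthogonal_modelSpace_iff {φ : HilbertBasis ℕ ℝ H} {m : ℕ} {L : HKer} :
    L ∈ (modelSpace φ m)ᗮ ↔ ∀ j < m, integralOp L (φ j) = 0 := by
  constructor
  · intro hL j hj
    have h0 : ∀ k, ⟪φ k, integralOp L (φ j)⟫ = 0 := fun k => by
      rw [← inner_tensorKer]
      exact (Submodule.mem_orthogonal _ _).1 hL _ (Submodule.subset_span ⟨j, hj, k, rfl⟩)
    have h1 := φ.hasSum_inner_mul_inner (integralOp L (φ j)) (integralOp L (φ j))
    simp only [h0, mul_zero] at h1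
    exact inner_self_eq_zero.1 (h1.unique hasSum_zero)
  · intro h
    rw [modelSpace, Submodule.mem_orthogonal]
    intro u hu
    induction hu using Submodule.span_induction with
    | mem x hx =>
      obtain ⟨j, hj, k, rfl⟩ := hx
      rw [inner_tensorKer, h j hj, inner_zero_right]
    | zero => simp
    | add x y _ _ hx hy => rw [inner_add_left, hx, hy, add_zero]
    | smul c x _ hx => rw [inner_smul_left, hx, mul_zero]

/-- The projection of an operator `S` on the model of dimension `m` is the composition of `S` with
the orthogonal projection on the first `m` vectors of the basis. -/
theorem projOp_apply (φ : HilbertBasis ℕ ℝ H) (m : ℕ) (K : HKer) (f : H) :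
    projOp φ m K f = ∑ j ∈ Finset.range m, ⟪φ j, f⟫ • integralOp K (φ j) := by
  set L : HKer := ∑ j ∈ Finset.range m, tensorKer (integralOp K (φ j)) (φ j) with hL
  have happ : ∀ g, integralOp L g = ∑ j ∈ Finset.range m, ⟪φ j, g⟫ • integralOp K (φ j) := by
    intro g
    simp [hL, integralOp_sum_apply, integralOp_tensorKer]
  have hmem : L ∈ (modelSpace φ m).topologicalClosure := by
    rw [← Submodule.orthogonal_orthogonal_eq_closure]
    refine Submodule.sum_mem _ fun j hj => ?_
    rw [Submodule.mem_orthogonal']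
    intro T hT
    rw [inner_tensorKer, mem_orthogonal_modelSpace_iff.1 hT j (Finset.mem_range.1 hj),
      inner_zero_right]
  have horth : K - L ∈ (modelSpace φ m).topologicalClosureᗮ := by
    rw [Submodule.orthogonal_closure, mem_orthogonal_modelSpace_iff]
    intro l hl
    rw [integralOp_sub_apply, happ]
    simp [orthonormal_iff_ite.1 φ.orthonormal, hl]
  rw [projOp, Submodule.eq_starProjection_of_mem_orthogonal hmem horth, happ]

/-! ### The hat matrix of the regression on the empirical principal components -/

variable {n : ℕ}

/-- The matrix of the orthogonal projection of `ℝⁿ` on the span of the score vectors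
`(⟪φ j, x i⟫)ᵢ`, `j < m`. Null score vectors do not contribute, since `0⁻¹ = 0`. -/
noncomputable def hatMatrix (x : Fin n → H) (φ : HilbertBasis ℕ ℝ H) (m : ℕ) (i k : Fin n) : ℝ :=
  ∑ j ∈ Finset.range m, (n * empEigenvalue x φ j)⁻¹ * (⟪φ j, x i⟫ * ⟪φ j, x k⟫)

theorem hatMatrix_symm (x : Fin n → H) (φ : HilbertBasis ℕ ℝ H) (m : ℕ) (i k : Fin n) :
    hatMatrix x φ m i k = hatMatrix x φ m k i := by
  simp only [hatMatrix, mul_comm ⟪φ _, x i⟫]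

theorem empCov_apply (x : Fin n → H) (f : H) :
    empCov x f = (n : ℝ)⁻¹ • ∑ i, ⟪x i, f⟫ • x i := by
  simp [empCov]

namespace IsEmpPCABasis

variable {x : Fin n → H} {φ : HilbertBasis ℕ ℝ H}

theorem sum_smul_eq (h : IsEmpPCABasis x φ) (hn : 1 ≤ n) (j : ℕ) :
    ∑ i, ⟪φ j, x i⟫ • x i = (n * empEigenvalue x φ j) • φ j := by
  have hn0 : (n : ℝ) ≠ 0 := by positivity
  have := h.eigen j
  rw [empCov_apply] at this
  rw [mul_smul, ← this, smul_smul, mul_inv_cancel₀ hn0, one_smul]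
  simp_rw [real_inner_comm]

/-- Score vectors are orthogonal, with squared norms `n λ̂ⱼ`. -/
theorem sum_inner_mul_inner (h : IsEmpPCABasis x φ) (hn : 1 ≤ n) (j l : ℕ) :
    ∑ i, ⟪φ j, x i⟫ * ⟪φ l, x i⟫ = if j = l then n * empEigenvalue x φ j else 0 := by
  have := congrArg (fun f => ⟪φ l, f⟫) (h.sum_smul_eq hn j)
  simp only [inner_sum, inner_smul_right] at this
  rw [this, orthonormal_iff_ite.1 φ.orthonormal]
  simp [eq_comm]

theorem inner_eq_zero (h : IsEmpPCABasis x φ) (hn : 1 ≤ n) {j : ℕ}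
    (hj : n * empEigenvalue x φ j = 0) (i : Fin n) : ⟪φ j, x i⟫ = 0 := by
  have := h.sum_inner_mul_inner hn j j
  rw [if_pos rfl, hj, Finset.sum_eq_zero_iff_of_nonneg fun i _ => mul_self_nonneg _] at this
  exact mul_self_eq_zero.1 (this i (Finset.mem_univ i))

/-- The hat matrices are the matrices of a nested family of orthogonal projections. -/
theorem sum_hatMatrix_mul (h : IsEmpPCABasis x φ) (hn : 1 ≤ n) (m l : ℕ) (i k : Fin n) :
    ∑ r, hatMatrix x φ m i r * hatMatrix x φ l r k = hatMatrix x φ (min m l) i k := by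
  have hrange : Finset.range (min m l) = (Finset.range m).filter (· < l) := by
    ext j
    simp
  rw [hatMatrix, hrange, Finset.sum_filter]
  simp_rw [hatMatrix, Finset.sum_mul_sum]
  rw [Finset.sum_comm]
  refine Finset.sum_congr rfl fun j _ => ?_
  rw [Finset.sum_comm]
  have hsum : ∀ q, ∑ r, (n * empEigenvalue x φ j)⁻¹ * (⟪φ j, x i⟫ * ⟪φ j, x r⟫) *
      ((n * empEigenvalue x φ q)⁻¹ * (⟪φ q, x r⟫ * ⟪φ q, x k⟫)) =
      if j = q then (n * empEigenvalue x φ j)⁻¹ * (⟪φ j, x i⟫ * ⟪φ j, x k⟫) else 0 := by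
    intro q
    have : ∀ r, (n * empEigenvalue x φ j)⁻¹ * (⟪φ j, x i⟫ * ⟪φ j, x r⟫) *
      ((n * empEigenvalue x φ q)⁻¹ * (⟪φ q, x r⟫ * ⟪φ q, x k⟫)) =
      (n * empEigenvalue x φ j)⁻¹ * ⟪φ j, x i⟫ * (n * empEigenvalue x φ q)⁻¹ * ⟪φ q, x k⟫ *
        (⟪φ j, x r⟫ * ⟪φ q, x r⟫) := fun r => by ring
    simp_rw [this]
    rw [← Finset.mul_sum, h.sum_inner_mul_inner hn]
    split_ifs with hjq
    · subst hjq
      by_cases hj : n * empEigenvalue x φ j = 0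
      · rw [hj]; simp
      · field_simp
    · rw [mul_zero]
  simp_rw [hsum]
  simp

theorem sum_hatMatrix_diag_le (h : IsEmpPCABasis x φ) (hn : 1 ≤ n) (m : ℕ) :
    ∑ i, hatMatrix x φ m i i ≤ m := by
  unfold hatMatrix
  rw [Finset.sum_comm]
  simp_rw [← Finset.mul_sum, h.sum_inner_mul_inner hn, if_true]
  calc ∑ j ∈ Finset.range m, (n * empEigenvalue x φ j)⁻¹ * (n * empEigenvalue x φ j)
      ≤ ∑ j ∈ Finset.range m, (1 : ℝ) := Finset.sum_le_sum fun j _ => inv_mul_le_one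
    _ = m := by simp

/-- On the sample, the projection of an operator on a model is the projection of its values. -/
theorem projOp_apply_eq (h : IsEmpPCABasis x φ) (hn : 1 ≤ n) (m : ℕ) (K : HKer) (i : Fin n) :
    projOp φ m K (x i) = ∑ k, hatMatrix x φ m i k • integralOp K (x k) := by
  rw [projOp_apply]
  simp_rw [hatMatrix, Finset.sum_smul, ← map_smul]
  rw [Finset.sum_comm]
  refine Finset.sum_congr rfl fun j _ => ?_
  simp_rw [← map_sum, mul_smul, ← Finset.smul_sum, h.sum_smul_eq hn, smul_smul]
  congr 2
  by_cases hj : n * empEigenvalue x φ j = 0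
  · rw [h.inner_eq_zero hn hj]; simp
  · rw [mul_left_comm, inv_mul_cancel₀ hj, mul_one]

end IsEmpPCABasis

/-- On the sample, the slope estimator is the projection of the responses. -/
theorem slopeEst_apply_eq (x y : Fin n → H) (φ : HilbertBasis ℕ ℝ H) (m : ℕ) (i : Fin n) :
    slopeEst x y φ m (x i) = ∑ k, hatMatrix x φ m i k • y k := by
  simp only [slopeEst, empCrossCov, empPinv, ContinuousLinearMap.comp_apply,
    smul_apply, sum_apply, InnerProductSpace.rankOne_apply,
    inner_sum, inner_smul_right, Finset.smul_sum, Finset.sum_smul, hatMatrix, smul_smul]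
  refine Finset.sum_congr rfl fun k _ => Finset.sum_congr rfl fun j _ => ?_
  congr 1
  rw [real_inner_comm (φ j) (x k), mul_inv]
  ring

/-! ### Moment inequalities for linear and quadratic forms in independent vectors -/

section Moments

variable {Ω : Type*} [MeasurableSpace Ω] {P : Measure Ω}

/-- Fubini for an independent pair, as one step of a martingale argument: if `g u` has mean at most
`h u` under the law of `V` for each frozen value `u` of the past, then `g (U, V)` is integrable, with
mean at most that of `h U`. -/
theorem integrable_and_integral_le_of_indepFun [IsProbabilityMeasure P] {α β : Type*}
    [MeasurableSpace α] [MeasurableSpace β] {U : Ω → α} {V : Ω → β} (hU : Measurable U)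
    (hV : Measurable V) (hUV : IndepFun U V P)
    {g : α → β → ℝ} (hg : Measurable (Function.uncurry g)) (hg0 : ∀ u v, 0 ≤ g u v)
    {h : α → ℝ} (hgi : ∀ u, Integrable (fun ω => g u (V ω)) P)
    (hgh : ∀ u, ∫ ω, g u (V ω) ∂P ≤ h u) (hh : Integrable (fun ω => h (U ω)) P) :
    Integrable (fun ω => g (U ω) (V ω)) P ∧ ∫ ω, g (U ω) (V ω) ∂P ≤ ∫ ω, h (U ω) ∂P := by
  have hh0 : ∀ u, 0 ≤ h u := fun u => (integral_nonneg fun ω => hg0 u _).trans (hgh u)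
  have key : ∫⁻ ω, ENNReal.ofReal (g (U ω) (V ω)) ∂P ≤ ∫⁻ ω, ENNReal.ofReal (h (U ω)) ∂P := by
    have hG : Measurable fun q : α × β => ENNReal.ofReal (g q.1 q.2) := hg.ennreal_ofReal
    have e1 : ∫⁻ ω, ENNReal.ofReal (g (U ω) (V ω)) ∂P =
        ∫⁻ ω, ∫⁻ ω', ENNReal.ofReal (g (U ω) (V ω')) ∂P ∂P := by
      have := lintegral_map (μ := P) hG (hU.prodMk hV)
      rw [(indepFun_iff_map_prod_eq_prod_map_map hU.aemeasurable hV.aemeasurable).1 hUV] at this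
      rw [← this]
      have := Measure.isProbabilityMeasure_map (μ := P) hU.aemeasurable
      have := Measure.isProbabilityMeasure_map (μ := P) hV.aemeasurable
      rw [lintegral_prod _ hG.aemeasurable, lintegral_map hG.lintegral_prod_right' hU]
      refine lintegral_congr fun ω => ?_
      exact lintegral_map (hG.comp measurable_prodMk_left) hV
    rw [e1]
    refine lintegral_mono fun ω => ?_
    rw [← ofReal_integral_eq_lintegral_ofReal (hgi _) (Filter.Eventually.of_forall fun _ => hg0 _ _)]
    exact ENNReal.ofReal_le_ofReal (hgh _)
  have hm : Measurable fun ω => g (U ω) (V ω) := hg.comp (hU.prodMk hV)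
  have hi : Integrable (fun ω => g (U ω) (V ω)) P := by
    refine ⟨hm.aestronglyMeasurable, ?_⟩
    rw [hasFiniteIntegral_iff_ofReal (Filter.Eventually.of_forall fun _ => hg0 _ _)]
    refine key.trans_lt ?_
    have := hh.2
    rwa [hasFiniteIntegral_iff_ofReal (Filter.Eventually.of_forall fun _ => hh0 _)] at this
  refine ⟨hi, ?_⟩
  rw [← ofReal_integral_eq_lintegral_ofReal hi (Filter.Eventually.of_forall fun _ => hg0 _ _),
    ← ofReal_integral_eq_lintegral_ofReal hh (Filter.Eventually.of_forall fun _ => hh0 _)] at key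
  exact (ENNReal.ofReal_le_ofReal_iff (integral_nonneg fun _ => hh0 _)).1 key

/-- The mixed terms of degree at least two in `x` are absorbed by the two extreme ones. -/
theorem add_pow_six_le (l x : ℝ) :
    (l + x) ^ 6 ≤ l ^ 6 + 6 * l ^ 5 * x + (39 * l ^ 4 * x ^ 2 + 18 * x ^ 6) := by
  nlinarith [mul_nonneg (sq_nonneg (l * x)) (sq_nonneg (l - x)),
    mul_nonneg (sq_nonneg (x * x)) (sq_nonneg (l - x)),
    mul_nonneg (sq_nonneg x) (sq_nonneg (l ^ 2 - x ^ 2))]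

theorem sum_smul_piecewise {E : Type*} [NormedAddCommGroup E] [NormedSpace ℝ E] {ι : Type*}
    [DecidableEq ι] (a : ι → ℝ) (s : Finset ι) (u : ι → E) :
    ∑ j ∈ s, a j • s.piecewise u 0 j = ∑ j ∈ s, a j • u j :=
  Finset.sum_congr rfl fun j hj => by simp [hj]

/-- A family of independent centered vectors with variance `v` whose moments of order at most `6`
are all bounded by `κ`. -/
structure IsNoise {E : Type*} [NormedAddCommGroup E] [NormedSpace ℝ E] [MeasurableSpace E] {ι : Type*}
    (P : Measure Ω) (ε : ι → Ω → E) (v κ : ℝ) : Prop where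
  measurable : ∀ i, Measurable (ε i)
  iIndep : iIndepFun ε P
  mean : ∀ i, ∫ ω, ε i ω ∂P = 0
  variance : ∀ i, ∫ ω, ‖ε i ω‖ ^ 2 ∂P = v
  integrable_pow : ∀ i, ∀ k ≤ 6, Integrable (fun ω => ‖ε i ω‖ ^ k) P
  moment_le : ∀ i, ∀ k ≤ 6, ∫ ω, ‖ε i ω‖ ^ k ∂P ≤ κ

namespace IsNoise

variable {E : Type*} [NormedAddCommGroup E] [InnerProductSpace ℝ E] [MeasurableSpace E]
  {ι : Type*} {ε : ι → Ω → E} {v κ : ℝ}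

theorem one_le [IsProbabilityMeasure P] (h : IsNoise P ε v κ) (i : ι) : 1 ≤ κ := by
  simpa using h.moment_le i 0 (by norm_num)

theorem variance_le (h : IsNoise P ε v κ) (i : ι) : v ≤ κ :=
  (h.variance i).symm.le.trans (h.moment_le i 2 (by norm_num))

theorem variance_nonneg (h : IsNoise P ε v κ) (i : ι) : 0 ≤ v :=
  h.variance i ▸ integral_nonneg fun _ => by positivity

theorem ae_eq_zero [Countable ι] (h : IsNoise P ε 0 κ) : ∀ᵐ ω ∂P, ∀ i, ε i ω = 0 := by
  refine ae_all_iff.2 fun i => ?_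
  have := (integral_eq_zero_iff_of_nonneg (fun ω => sq_nonneg ‖ε i ω‖)
    (h.integrable_pow i 2 (by norm_num))).1 (h.variance i)
  filter_upwards [this] with ω hω
  simpa using hω

variable [BorelSpace E] [SecondCountableTopology E]

theorem integrable (h : IsNoise P ε v κ) (i : ι) : Integrable (ε i) P := by
  refine (integrable_norm_iff (h.measurable i).aestronglyMeasurable).1 ?_
  simpa using h.integrable_pow i 1 (by norm_num)

variable [IsProbabilityMeasure P] [CompleteSpace E]

/-- The mean of a nonnegative function of one noise vector which is dominated by a polynomial: the
linear term and the centered quadratic term do not contribute. -/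
theorem integrable_and_integral_le (h : IsNoise P ε v κ) (i : ι) {f : E → ℝ} (hf : Measurable f)
    (hf0 : ∀ e, 0 ≤ f e) {b a c₂ c₄ c₆ : ℝ} {w : E} (hc₂ : 0 ≤ c₂) (hc₄ : 0 ≤ c₄) (hc₆ : 0 ≤ c₆)
    (hle : ∀ e, f e ≤ b + ⟪w, e⟫ + a * (‖e‖ ^ 2 - v) +
      (c₂ * ‖e‖ ^ 2 + c₄ * ‖e‖ ^ 4 + c₆ * ‖e‖ ^ 6)) :
    Integrable (fun ω => f (ε i ω)) P ∧ ∫ ω, f (ε i ω) ∂P ≤ b + κ * (c₂ + c₄ + c₆) := by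
  have i1 : Integrable (fun ω => ⟪w, ε i ω⟫) P := (h.integrable i).const_inner w
  have i2 := h.integrable_pow i 2 (by norm_num)
  have i4 := h.integrable_pow i 4 (by norm_num)
  have i6 := h.integrable_pow i 6 (by norm_num)
  have j1 : Integrable (fun ω => b + ⟪w, ε i ω⟫ + a * (‖ε i ω‖ ^ 2 - v)) P :=
    ((integrable_const b).add i1).add ((i2.sub (integrable_const v)).const_mul a)
  have j2 : Integrable (fun ω => c₂ * ‖ε i ω‖ ^ 2 + c₄ * ‖ε i ω‖ ^ 4 + c₆ * ‖ε i ω‖ ^ 6) P :=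
    ((i2.const_mul _).add (i4.const_mul _)).add (i6.const_mul _)
  have hi : Integrable (fun ω => f (ε i ω)) P := by
    refine (j1.add j2).mono' (hf.comp (h.measurable i)).aestronglyMeasurable
      (Filter.Eventually.of_forall fun ω => ?_)
    rw [Real.norm_of_nonneg (hf0 _)]
    exact hle _
  refine ⟨hi, (integral_mono hi (j1.add j2) fun ω => hle _).trans ?_⟩
  have e0 : ∫ ω, ⟪w, ε i ω⟫ ∂P = 0 := by
    rw [integral_inner (h.integrable i), h.mean i, inner_zero_right]
  have e1 : ∫ ω, (b + ⟪w, ε i ω⟫ + a * (‖ε i ω‖ ^ 2 - v)) ∂P = b := by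
    have k1 : Integrable (fun ω => b + ⟪w, ε i ω⟫) P := (integrable_const b).add i1
    have k2 : Integrable (fun ω => a * (‖ε i ω‖ ^ 2 - v)) P :=
      (i2.sub (integrable_const v)).const_mul a
    rw [integral_add k1 k2, integral_add (integrable_const b) i1, integral_const_mul,
      integral_sub i2 (integrable_const v), e0, h.variance i]
    simp
  have e2 : ∫ ω, (c₂ * ‖ε i ω‖ ^ 2 + c₄ * ‖ε i ω‖ ^ 4 + c₆ * ‖ε i ω‖ ^ 6) ∂P ≤
      κ * (c₂ + c₄ + c₆) := by
    have k1 : Integrable (fun ω => c₂ * ‖ε i ω‖ ^ 2 + c₄ * ‖ε i ω‖ ^ 4) P :=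
      (i2.const_mul _).add (i4.const_mul _)
    rw [integral_add k1 (i6.const_mul _),
      integral_add (i2.const_mul _) (i4.const_mul _), integral_const_mul, integral_const_mul,
      integral_const_mul]
    have := mul_le_mul_of_nonneg_left (h.moment_le i 2 (by norm_num)) hc₂
    have := mul_le_mul_of_nonneg_left (h.moment_le i 4 (by norm_num)) hc₄
    have := mul_le_mul_of_nonneg_left (h.moment_le i 6 (by norm_num)) hc₆
    linarith
  simp only [Pi.add_apply]
  rw [integral_add j1 j2, e1]
  linarith

variable [DecidableEq ι]

/-- One step of a martingale argument: the mean of a function of the noise vectors indexed by `s`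
and of one further noise vector. -/
theorem step (h : IsNoise P ε v κ) {s : Finset ι} {i : ι} (hi : i ∉ s) {g : (ι → E) → E → ℝ}
    (hg : Measurable (Function.uncurry g)) (hg0 : ∀ u e, 0 ≤ g u e)
    {b a c₂ c₄ c₆ : (ι → E) → ℝ} {w : (ι → E) → E}
    (hgs : ∀ u e, g (s.piecewise u 0) e = g u e) (hb : ∀ u, b (s.piecewise u 0) = b u)
    (hcs₂ : ∀ u, c₂ (s.piecewise u 0) = c₂ u) (hcs₄ : ∀ u, c₄ (s.piecewise u 0) = c₄ u)
    (hcs₆ : ∀ u, c₆ (s.piecewise u 0) = c₆ u)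
    (hc₂ : ∀ u, 0 ≤ c₂ u) (hc₄ : ∀ u, 0 ≤ c₄ u) (hc₆ : ∀ u, 0 ≤ c₆ u)
    (hle : ∀ u e, g u e ≤ b u + ⟪w u, e⟫ + a u * (‖e‖ ^ 2 - v) +
      (c₂ u * ‖e‖ ^ 2 + c₄ u * ‖e‖ ^ 4 + c₆ u * ‖e‖ ^ 6))
    (hint : Integrable (fun ω => b (fun j => ε j ω) + κ * (c₂ (fun j => ε j ω) +
      c₄ (fun j => ε j ω) + c₆ (fun j => ε j ω))) P) :
    Integrable (fun ω => g (fun j => ε j ω) (ε i ω)) P ∧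
      ∫ ω, g (fun j => ε j ω) (ε i ω) ∂P ≤ ∫ ω, (b (fun j => ε j ω) + κ * (c₂ (fun j => ε j ω) +
      c₄ (fun j => ε j ω) + c₆ (fun j => ε j ω))) ∂P := by
  set U : Ω → ι → E := fun ω => s.piecewise (fun j => ε j ω) 0 with hUdef
  have hext : Measurable fun (q : s → E) (j : ι) => if hj : j ∈ s then q ⟨j, hj⟩ else 0 := by
    refine measurable_pi_lambda _ fun j => ?_
    by_cases hj : j ∈ s
    · simpa [hj] using measurable_pi_apply _
    · simp [hj]
  have hUind : IndepFun U (ε i) P := by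
    have h1 := (h.iIndep.indepFun_finset s {i} (by simpa using hi) h.measurable).comp hext
      (measurable_pi_apply (⟨i, Finset.mem_singleton_self i⟩ : ({i} : Finset ι)))
    refine h1.congr ?_ ?_
    · refine Filter.Eventually.of_forall fun ω => funext fun j => ?_
      by_cases hj : j ∈ s <;> simp [hUdef, hj]
    · exact Filter.Eventually.of_forall fun ω => rfl
  have hUm : Measurable U := by
    refine measurable_pi_lambda _ fun j => ?_
    by_cases hj : j ∈ s
    · simpa [hUdef, hj] using h.measurable j
    · simp [hUdef, hj]
  have key := integrable_and_integral_le_of_indepFun hUm (h.measurable i) hUind hg hg0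
    (h := fun u => b u + κ * (c₂ u + c₄ u + c₆ u))
    (fun u => (h.integrable_and_integral_le i (hg.comp measurable_prodMk_left) (hg0 u)
      (hc₂ u) (hc₄ u) (hc₆ u) (hle u)).1)
    (fun u => (h.integrable_and_integral_le i (hg.comp measurable_prodMk_left) (hg0 u)
      (hc₂ u) (hc₄ u) (hc₆ u) (hle u)).2)
    (by simpa only [hUdef, hb, hcs₂, hcs₄, hcs₆] using hint)
  simpa only [hUdef, hb, hcs₂, hcs₄, hcs₆, hgs] using key

theorem integral_norm_sum_smul_sq_le (h : IsNoise P ε v κ) (a : ι → ℝ) (s : Finset ι) :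
    Integrable (fun ω => ‖∑ j ∈ s, a j • ε j ω‖ ^ 2) P ∧
      ∫ ω, ‖∑ j ∈ s, a j • ε j ω‖ ^ 2 ∂P ≤ κ * ∑ j ∈ s, a j ^ 2 := by
  induction s using Finset.induction_on with
  | empty => simp
  | insert i s hi ih =>
    have hint := ih.1.add (integrable_const (κ * (a i ^ 2 + 0 + 0)))
    have key := h.step hi (g := fun u e => ‖a i • e + ∑ j ∈ s, a j • u j‖ ^ 2)
      (by fun_prop) (fun _ _ => by positivity)
      (b := fun u => ‖∑ j ∈ s, a j • u j‖ ^ 2) (a := fun _ => 0) (c₂ := fun _ => a i ^ 2)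
      (c₄ := fun _ => 0) (c₆ := fun _ => 0)
      (w := fun u => (2 * a i) • ∑ j ∈ s, a j • u j)
      (by simp [sum_smul_piecewise]) (by simp [sum_smul_piecewise]) (fun _ => rfl) (fun _ => rfl)
      (fun _ => rfl) (fun _ => by positivity) (fun _ => le_rfl) (fun _ => le_rfl)
      (fun u e => by
        rw [norm_add_sq_real, norm_smul, mul_pow, Real.norm_eq_abs, sq_abs, inner_smul_left,
          inner_smul_left, real_inner_comm]
        simp only [conj_trivial]
        linarith) hint
    simp_rw [Finset.sum_insert hi]
    refine ⟨key.1, key.2.trans ?_⟩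
    rw [integral_add ih.1 (integrable_const _), integral_const, probReal_univ, one_smul]
    linarith [ih.2]

theorem integral_norm_sum_smul_pow_four_le (h : IsNoise P ε v κ) (a : ι → ℝ) (s : Finset ι) :
    Integrable (fun ω => ‖∑ j ∈ s, a j • ε j ω‖ ^ 4) P ∧
      ∫ ω, ‖∑ j ∈ s, a j • ε j ω‖ ^ 4 ∂P ≤ 4 * κ ^ 2 * (∑ j ∈ s, a j ^ 2) ^ 2 := by
  induction s using Finset.induction_on with
  | empty => simp
  | insert i s hi ih =>
    have hκ := h.one_le i
    have h2 := h.integral_norm_sum_smul_sq_le a s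
    have i1 : Integrable (fun ω => κ * (8 * a i ^ 2 * ‖∑ j ∈ s, a j • ε j ω‖ ^ 2 + 3 * a i ^ 4 + 0))
      P := by
      have := h2.1
      fun_prop
    have key := h.step hi (g := fun u e => ‖a i • e + ∑ j ∈ s, a j • u j‖ ^ 4)
      (by fun_prop) (fun _ _ => by positivity)
      (b := fun u => ‖∑ j ∈ s, a j • u j‖ ^ 4) (a := fun _ => 0)
      (c₂ := fun u => 8 * a i ^ 2 * ‖∑ j ∈ s, a j • u j‖ ^ 2)
      (c₄ := fun _ => 3 * a i ^ 4) (c₆ := fun _ => 0)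
      (w := fun u => (4 * a i * ‖∑ j ∈ s, a j • u j‖ ^ 2) • ∑ j ∈ s, a j • u j)
      (by simp [sum_smul_piecewise]) (by simp [sum_smul_piecewise])
      (by simp [sum_smul_piecewise]) (fun _ => rfl)
      (fun _ => rfl) (fun _ => by positivity) (fun _ => by positivity) (fun _ => le_rfl)
      (fun u e => by
        set V := ∑ j ∈ s, a j • u j
        have e1 : ‖a i • e + V‖ ^ 2 = a i ^ 2 * ‖e‖ ^ 2 + 2 * (a i * ⟪V, e⟫) + ‖V‖ ^ 2 := by
          rw [norm_add_sq_real, norm_smul, mul_pow, Real.norm_eq_abs, sq_abs, inner_smul_left,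
            real_inner_comm]
          simp
        have e2 : ‖a i • e + V‖ ^ 4 = (a i ^ 2 * ‖e‖ ^ 2 + 2 * (a i * ⟪V, e⟫) + ‖V‖ ^ 2) ^ 2 := by
          rw [← e1]; ring
        have e3 : (a i * ⟪V, e⟫) ^ 2 ≤ (a i ^ 2 * ‖e‖ ^ 2) * ‖V‖ ^ 2 := by
          have := real_inner_mul_inner_self_le V e
          rw [real_inner_self_eq_norm_sq, real_inner_self_eq_norm_sq] at this
          nlinarith [mul_le_mul_of_nonneg_left this (sq_nonneg (a i))]
        rw [e2, inner_smul_left, conj_trivial]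
        nlinarith [sq_nonneg (a i * ⟪V, e⟫ - a i ^ 2 * ‖e‖ ^ 2)]) (ih.1.add i1)
    simp_rw [Finset.sum_insert hi]
    refine ⟨key.1, key.2.trans ?_⟩
    have e1 : ∫ ω, κ * (8 * a i ^ 2 * ‖∑ j ∈ s, a j • ε j ω‖ ^ 2 + 3 * a i ^ 4 + 0) ∂P =
        κ * (8 * a i ^ 2 * ∫ ω, ‖∑ j ∈ s, a j • ε j ω‖ ^ 2 ∂P + 3 * a i ^ 4) := by
      simp only [add_zero]
      rw [integral_const_mul, integral_add (h2.1.const_mul _) (integrable_const _),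
        integral_const_mul, integral_const, probReal_univ, one_smul]
    rw [integral_add ih.1 i1, e1]
    have hs : 0 ≤ ∑ j ∈ s, a j ^ 2 := Finset.sum_nonneg fun _ _ => sq_nonneg _
    have h3 := mul_le_mul_of_nonneg_left h2.2 (by positivity : 0 ≤ κ * (8 * a i ^ 2))
    have h4 : κ * a i ^ 4 ≤ κ ^ 2 * a i ^ 4 :=
      mul_le_mul_of_nonneg_right (by nlinarith) (by positivity)
    have h5 : 0 ≤ κ ^ 2 * a i ^ 4 := by positivity
    nlinarith [ih.2]

/-- A linear form in the noise with coefficients of total squared norm at most one has a sixth moment bounded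
independently of the number of vectors. -/
theorem integral_sum_inner_pow_six_le (h : IsNoise P ε v κ) {c : ι → E} {s : Finset ι}
    (hc : ∑ j ∈ s, ‖c j‖ ^ 2 ≤ 1) :
    Integrable (fun ω => (∑ j ∈ s, ⟪c j, ε j ω⟫) ^ 6) P ∧
      ∫ ω, (∑ j ∈ s, ⟪c j, ε j ω⟫) ^ 6 ∂P ≤ Real.exp (57 * κ) := by
  have hκ : s.Nonempty → 0 ≤ κ := fun ⟨i, _⟩ => zero_le_one.trans (h.one_le i)
  suffices H : ∀ t ⊆ s, Integrable (fun ω => (∑ j ∈ t, ⟪c j, ε j ω⟫) ^ 6) P ∧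
      1 + ∫ ω, (∑ j ∈ t, ⟪c j, ε j ω⟫) ^ 6 ∂P ≤ Real.exp (57 * κ * ∑ j ∈ t, ‖c j‖ ^ 2) by
    rcases s.eq_empty_or_nonempty with rfl | hs
    · simpa using (Real.exp_pos _).le
    · refine ⟨(H s subset_rfl).1, ?_⟩
      have h1 := (H s subset_rfl).2
      have h2 : Real.exp (57 * κ * ∑ j ∈ s, ‖c j‖ ^ 2) ≤ Real.exp (57 * κ) :=
        Real.exp_le_exp.2 (mul_le_of_le_one_right (by have := hκ hs; positivity) hc)
      linarith
  intro t
  induction t using Finset.induction_on with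
  | empty => simp
  | insert i t hi ih =>
    intro ht
    have hκ := h.one_le i
    have ih := ih ((Finset.subset_insert i t).trans ht)
    set d := ‖c i‖ ^ 2 with hd
    have hd0 : 0 ≤ d := by positivity
    have hd1 : d ≤ 1 :=
      (Finset.single_le_sum (fun j _ => sq_nonneg ‖c j‖) (ht (Finset.mem_insert_self i t))).trans hc
    have hpw : ∀ u : ι → E, ∑ j ∈ t, ⟪c j, t.piecewise u 0 j⟫ = ∑ j ∈ t, ⟪c j, u j⟫ := fun u =>
      Finset.sum_congr rfl fun j hj => by simp [hj]
    have hpos : ∀ l : ℝ, 0 ≤ l ^ 6 := fun l => by positivity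
    have i1 : Integrable (fun ω => κ * (39 * (1 + (∑ j ∈ t, ⟪c j, ε j ω⟫) ^ 6) * d + 0 + 18 * d)) P
      := by
      have := ih.1
      fun_prop
    have key := h.step hi (g := fun u e => (⟪c i, e⟫ + ∑ j ∈ t, ⟪c j, u j⟫) ^ 6)
      (by fun_prop) (fun _ _ => by positivity)
      (b := fun u => (∑ j ∈ t, ⟪c j, u j⟫) ^ 6) (a := fun _ => 0)
      (c₂ := fun u => 39 * (1 + (∑ j ∈ t, ⟪c j, u j⟫) ^ 6) * d)
      (c₄ := fun _ => 0) (c₆ := fun _ => 18 * d)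
      (w := fun u => (6 * (∑ j ∈ t, ⟪c j, u j⟫) ^ 5) • c i)
      (by simp [hpw]) (by simp [hpw]) (by simp [hpw]) (fun _ => rfl)
      (fun _ => rfl) (fun u => by have := hpos (∑ j ∈ t, ⟪c j, u j⟫); positivity)
      (fun _ => le_rfl) (fun _ => by positivity)
      (fun u e => by
        set l := ∑ j ∈ t, ⟪c j, u j⟫
        have e1 : ⟪c i, e⟫ ^ 2 ≤ d * ‖e‖ ^ 2 := by
          have := real_inner_mul_inner_self_le (c i) e
          rw [real_inner_self_eq_norm_sq, real_inner_self_eq_norm_sq] at this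
          rw [sq]; exact this
        have e2 : l ^ 4 ≤ 1 + l ^ 6 := by
          nlinarith [sq_nonneg (l ^ 2 - 1), mul_nonneg (sq_nonneg l) (sq_nonneg (l ^ 2 - 1))]
        have e3 : ⟪c i, e⟫ ^ 6 ≤ d * ‖e‖ ^ 6 := by
          calc ⟪c i, e⟫ ^ 6 = (⟪c i, e⟫ ^ 2) ^ 3 := by ring
            _ ≤ (d * ‖e‖ ^ 2) ^ 3 := by gcongr
            _ = d ^ 3 * ‖e‖ ^ 6 := by ring
            _ ≤ d * ‖e‖ ^ 6 := by
              gcongr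
              exact pow_le_of_le_one hd0 hd1 (by norm_num)
        have e4 : l ^ 4 * ⟪c i, e⟫ ^ 2 ≤ (1 + l ^ 6) * (d * ‖e‖ ^ 2) :=
          mul_le_mul e2 e1 (sq_nonneg _) (by have := hpos l; positivity)
        have e5 := add_pow_six_le l ⟪c i, e⟫
        rw [inner_smul_left, conj_trivial, add_comm]
        linarith) (ih.1.add i1)
    simp_rw [Finset.sum_insert hi]
    refine ⟨key.1, (add_le_add_right key.2 1).trans ?_⟩
    have e1 : ∫ ω, κ * (39 * (1 + (∑ j ∈ t, ⟪c j, ε j ω⟫) ^ 6) * d + 0 + 18 * d) ∂P =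
        κ * (39 * (1 + ∫ ω, (∑ j ∈ t, ⟪c j, ε j ω⟫) ^ 6 ∂P) * d + 18 * d) := by
      have k1 : Integrable (fun ω => 1 + (∑ j ∈ t, ⟪c j, ε j ω⟫) ^ 6) P :=
        (integrable_const _).add ih.1
      simp only [add_zero]
      rw [integral_const_mul, integral_add ((k1.const_mul _).mul_const _) (integrable_const _),
        integral_mul_const, integral_const_mul, integral_add (integrable_const _) ih.1,
        integral_const, integral_const, probReal_univ, one_smul, one_smul]
    rw [integral_add ih.1 i1, e1]
    set J := ∫ ω, (∑ j ∈ t, ⟪c j, ε j ω⟫) ^ 6 ∂P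
    have hJ : 0 ≤ J := integral_nonneg fun _ => by positivity
    calc 1 + (J + κ * (39 * (1 + J) * d + 18 * d)) ≤ (1 + J) * (57 * κ * d + 1) := by
          have : 0 ≤ κ * d * J := by positivity
          nlinarith
      _ ≤ Real.exp (57 * κ * ∑ j ∈ t, ‖c j‖ ^ 2) * Real.exp (57 * κ * d) :=
          mul_le_mul ih.2 (Real.add_one_le_exp _) (by positivity) (Real.exp_pos _).le
      _ = _ := by rw [← Real.exp_add]; congr 1; ring

end IsNoise

/-- The third-order Taylor bound of `|·| ^ 3`, with a linear term which is exact in `d`. -/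
theorem abs_add_pow_three_le (x d : ℝ) :
    |x + d| ^ 3 ≤ |x| ^ 3 + 3 * |x| * x * d + 3 * |x| * d ^ 2 + |d| ^ 3 := by
  have key : ∀ x d : ℝ, 0 ≤ x →
      |x + d| ^ 3 ≤ |x| ^ 3 + 3 * |x| * x * d + 3 * |x| * d ^ 2 + |d| ^ 3 := by
    intro x d hx
    rw [abs_of_nonneg hx]
    rcases le_total 0 (x + d) with h | h
    · rw [abs_of_nonneg h]
      have := pow_abs d 3 ▸ le_abs_self (d ^ 3)
      nlinarith
    · have hd : d ≤ 0 := by linarith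
      rw [abs_of_nonpos h, abs_of_nonpos hd]
      nlinarith [mul_nonneg hx (add_nonneg (sq_nonneg (2 * x + 3 * d)) (sq_nonneg d))]
  rcases le_total 0 x with h | h
  · exact key x d h
  · have := key (-x) (-d) (by linarith)
    rw [← neg_add, abs_neg, abs_neg, abs_neg] at this
    linarith

theorem abs_sub_pow_three_le {p q : ℝ} (hp : 0 ≤ p) (hq : 0 ≤ q) : |p - q| ^ 3 ≤ p ^ 3 + q ^ 3 := by
  have h1 : |p - q| ≤ max p q :=
    abs_sub_le_iff.2 ⟨by linarith [le_max_left p q], by linarith [le_max_right p q]⟩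
  refine (pow_le_pow_left₀ (abs_nonneg _) h1 3).trans ?_
  rcases max_cases p q with ⟨h, -⟩ | ⟨h, -⟩ <;> rw [h]
  · linarith [pow_nonneg hq 3]
  · linarith [pow_nonneg hp 3]

theorem abs_mul_le_div_add_div {r α : ℝ} (hr : 0 < r) (hα : 0 < α) (x y : ℝ) :
    |x| * y ≤ (α * x ^ 2 / r + r * y ^ 2 / α) / 2 := by
  rw [← sq_abs x]
  have h1 : α * |x| ^ 2 / r + r * y ^ 2 / α - 2 * (|x| * y) = (α * |x| - r * y) ^ 2 / (r * α) := by
    field_simp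
    ring
  have h2 : 0 ≤ (α * |x| - r * y) ^ 2 / (r * α) := by positivity
  linarith

/-- The third absolute moment after one step of a martingale `R` with increment
`2 ⟪V, e⟫ + α (‖e‖² - v)`, where `T` and `W` dominate `|R|` and `|R| ‖V‖²`. The terms of the
first line of the bound have mean `|R|³` when `e` is centered with variance `v`. -/
theorem abs_add_increment_pow_three_le {E : Type*} [NormedAddCommGroup E] [InnerProductSpace ℝ E]
    (V e : E) {R α v T W : ℝ} (hα : 0 ≤ α) (hv : 0 ≤ v) (hRT : |R| ≤ T)
    (hRW : |R| * ‖V‖ ^ 2 ≤ W) :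
    |R + (2 * ⟪V, e⟫ + α * (‖e‖ ^ 2 - v))| ^ 3 ≤
      |R| ^ 3 + 6 * |R| * R * ⟪V, e⟫ + 3 * |R| * R * α * (‖e‖ ^ 2 - v) +
      (6 * α ^ 2 * v ^ 2 * T + 4 * α ^ 3 * v ^ 3) + ((24 * W + 16 * ‖V‖ ^ 2) * ‖e‖ ^ 2 +
      (6 * α ^ 2 * T + 16 * ‖V‖ ^ 4) * ‖e‖ ^ 4 + 4 * α ^ 3 * ‖e‖ ^ 6) := by
  have hT0 : 0 ≤ T := (abs_nonneg R).trans hRT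
  have e1 : |⟪V, e⟫| ≤ ‖V‖ * ‖e‖ := abs_real_inner_le_norm V e
  have e1' : ⟪V, e⟫ ^ 2 ≤ ‖V‖ ^ 2 * ‖e‖ ^ 2 := by
    rw [← sq_abs, ← mul_pow]
    gcongr
  have e2 : (‖e‖ ^ 2 - v) ^ 2 ≤ ‖e‖ ^ 4 + v ^ 2 := by
    nlinarith [mul_nonneg hv (sq_nonneg ‖e‖)]
  have e3 : |R| * ⟪V, e⟫ ^ 2 ≤ W * ‖e‖ ^ 2 := by
    calc |R| * ⟪V, e⟫ ^ 2 ≤ |R| * (‖V‖ ^ 2 * ‖e‖ ^ 2) := by gcongr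
      _ = |R| * ‖V‖ ^ 2 * ‖e‖ ^ 2 := by ring
      _ ≤ _ := by gcongr
  have e4 : α ^ 2 * (|R| * (‖e‖ ^ 2 - v) ^ 2) ≤ α ^ 2 * (T * (‖e‖ ^ 4 + v ^ 2)) := by
    gcongr
  have e5 : |⟪V, e⟫| ^ 3 ≤ (‖V‖ ^ 2 * ‖e‖ ^ 2 + ‖V‖ ^ 4 * ‖e‖ ^ 4) / 2 := by
    calc |⟪V, e⟫| ^ 3 ≤ (‖V‖ * ‖e‖) ^ 3 := by gcongr
      _ ≤ _ := by nlinarith [mul_nonneg (sq_nonneg (‖V‖ * ‖e‖)) (sq_nonneg (‖V‖ * ‖e‖ - 1))]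
  have e6 : |‖e‖ ^ 2 - v| ^ 3 ≤ ‖e‖ ^ 6 + v ^ 3 := by
    have := abs_sub_pow_three_le (sq_nonneg ‖e‖) hv
    rwa [← pow_mul] at this
  have e7 : |2 * ⟪V, e⟫ + α * (‖e‖ ^ 2 - v)| ^ 3 ≤
      16 * (‖V‖ ^ 2 * ‖e‖ ^ 2 + ‖V‖ ^ 4 * ‖e‖ ^ 4) + 4 * (α ^ 3 * (‖e‖ ^ 6 + v ^ 3)) := by
    have f1 : |2 * ⟪V, e⟫ + α * (‖e‖ ^ 2 - v)| ≤ 2 * |⟪V, e⟫| + α * |‖e‖ ^ 2 - v| := by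
      refine (abs_add_le _ _).trans_eq ?_
      rw [abs_mul, abs_mul, abs_two, abs_of_nonneg hα]
    have f2 : (2 * |⟪V, e⟫| + α * |‖e‖ ^ 2 - v|) ^ 3 ≤
        4 * ((2 * |⟪V, e⟫|) ^ 3 + (α * |‖e‖ ^ 2 - v|) ^ 3) := by
      have := add_pow_le (by positivity : 0 ≤ 2 * |⟪V, e⟫|)
        (by positivity : 0 ≤ α * |‖e‖ ^ 2 - v|) 3
      norm_num at this ⊢
      exact this
    have f3 : α ^ 3 * |‖e‖ ^ 2 - v| ^ 3 ≤ α ^ 3 * (‖e‖ ^ 6 + v ^ 3) := by gcongr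
    have := pow_le_pow_left₀ (abs_nonneg _) f1 3
    rw [mul_pow, mul_pow] at f2
    linarith
  have e8 := abs_add_pow_three_le R (2 * ⟪V, e⟫ + α * (‖e‖ ^ 2 - v))
  have e9 : 3 * |R| * (2 * ⟪V, e⟫ + α * (‖e‖ ^ 2 - v)) ^ 2 ≤
      24 * (|R| * ⟪V, e⟫ ^ 2) + 6 * (α ^ 2 * (|R| * (‖e‖ ^ 2 - v) ^ 2)) := by
    have := mul_nonneg (abs_nonneg R) (sq_nonneg (2 * ⟪V, e⟫ - α * (‖e‖ ^ 2 - v)))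
    linarith
  linarith

/-- The quadratic form `∑_{j,k ∈ s} A j k ⟪u j, u k⟫`. -/
noncomputable def quadForm {E : Type*} [NormedAddCommGroup E] [InnerProductSpace ℝ E] {ι : Type*}
    (A : ι → ι → ℝ) (s : Finset ι) (u : ι → E) : ℝ :=
  ∑ j ∈ s, ∑ k ∈ s, A j k * ⟪u j, u k⟫

section

variable {E : Type*} [NormedAddCommGroup E] [InnerProductSpace ℝ E] {ι : Type*}

theorem quadForm_insert [DecidableEq ι] {A : ι → ι → ℝ} (hA : ∀ i j, A i j = A j i) {s : Finset ι}
    {i : ι} (hi : i ∉ s) (u : ι → E) :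
    quadForm A (insert i s) u =
      quadForm A s u + 2 * ⟪∑ j ∈ s, A i j • u j, u i⟫ + A i i * ‖u i‖ ^ 2 := by
  simp only [quadForm, Finset.sum_insert hi, Finset.sum_add_distrib, real_inner_self_eq_norm_sq,
    sum_inner, inner_smul_left, conj_trivial]
  have : ∑ k ∈ s, A i k * ⟪u i, u k⟫ = ∑ k ∈ s, A i k * ⟪u k, u i⟫ :=
    Finset.sum_congr rfl fun k _ => by rw [real_inner_comm]
  rw [this]
  have : ∑ k ∈ s, A k i * ⟪u k, u i⟫ = ∑ k ∈ s, A i k * ⟪u k, u i⟫ :=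
    Finset.sum_congr rfl fun k _ => by rw [hA]
  rw [this]
  ring

theorem quadForm_piecewise [DecidableEq ι] (A : ι → ι → ℝ) (s : Finset ι) (u : ι → E) :
    quadForm A s (s.piecewise u 0) = quadForm A s u :=
  Finset.sum_congr rfl fun j hj => Finset.sum_congr rfl fun k hk => by simp [hj, hk]

theorem measurable_quadForm [MeasurableSpace E] [BorelSpace E] [SecondCountableTopology E]
    (A : ι → ι → ℝ) (s : Finset ι) :
    Measurable fun u : ι → E => quadForm A s u := by
  unfold quadForm
  fun_prop

end

namespace IsNoise

variable [IsProbabilityMeasure P] {E : Type*} [NormedAddCommGroup E] [InnerProductSpace ℝ E]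
  [MeasurableSpace E] {ι : Type*} {ε : ι → Ω → E} {v κ : ℝ} [DecidableEq ι]

variable [CompleteSpace E] [BorelSpace E] [SecondCountableTopology E]

/-- The variance of a quadratic form in the noise, along the martingale obtained by adding the noise
vectors one at a time. -/
theorem integral_quadForm_sub_sq_le [Fintype ι] (h : IsNoise P ε v κ) {A : ι → ι → ℝ}
    (hA : ∀ i j, A i j = A j i) (hA2 : ∀ i, ∑ j, A i j ^ 2 ≤ A i i) (s : Finset ι) :
    Integrable (fun ω => (quadForm A s (fun j => ε j ω) - v * ∑ j ∈ s, A j j) ^ 2) P ∧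
      ∫ ω, (quadForm A s (fun j => ε j ω) - v * ∑ j ∈ s, A j j) ^ 2 ∂P ≤
        12 * κ ^ 2 * ∑ j ∈ s, A j j := by
  induction s using Finset.induction_on with
  | empty => simp [quadForm]
  | insert i s hi ih =>
    have hκ := h.one_le i
    have hv := h.variance_le i
    have hv0 := h.variance_nonneg i
    have hAs : ∑ j ∈ s, A i j ^ 2 ≤ A i i :=
      (Finset.sum_le_univ_sum_of_nonneg fun _ => sq_nonneg _).trans (hA2 i)
    have hA0 : 0 ≤ A i i := (Finset.sum_nonneg fun _ _ => sq_nonneg _).trans (hA2 i)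
    have hA1 : A i i ^ 2 ≤ A i i :=
      (Finset.single_le_sum (fun j _ => sq_nonneg (A i j)) (Finset.mem_univ i)).trans (hA2 i)
    have hV := h.integral_norm_sum_smul_sq_le (A i) s
    set c := v * ∑ j ∈ s, A j j
    have i0 : Integrable (fun ω => (quadForm A s (fun j => ε j ω) - c) ^ 2 + 2 * A i i ^ 2 * v ^ 2) P
      := ih.1.add (integrable_const _)
    have i1 : Integrable (fun ω => κ * (8 * ‖∑ j ∈ s, A i j • ε j ω‖ ^ 2 + 2 * A i i ^ 2 + 0)) P := by
      have := hV.1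
      fun_prop
    have key := h.step hi
      (g := fun u e => (quadForm A s u - c + (2 * ⟪∑ j ∈ s, A i j • u j, e⟫ +
        A i i * (‖e‖ ^ 2 - v))) ^ 2)
      (by have := measurable_quadForm (E := E) A s; fun_prop) (fun _ _ => by positivity)
      (b := fun u => (quadForm A s u - c) ^ 2 + 2 * A i i ^ 2 * v ^ 2)
      (a := fun u => 2 * (quadForm A s u - c) * A i i)
      (c₂ := fun u => 8 * ‖∑ j ∈ s, A i j • u j‖ ^ 2)
      (c₄ := fun _ => 2 * A i i ^ 2) (c₆ := fun _ => 0)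
      (w := fun u => (4 * (quadForm A s u - c)) • ∑ j ∈ s, A i j • u j)
      (by simp [sum_smul_piecewise, quadForm_piecewise]) (by simp [quadForm_piecewise])
      (by simp [sum_smul_piecewise]) (fun _ => rfl)
      (fun _ => rfl) (fun _ => by positivity) (fun _ => by positivity) (fun _ => le_rfl)
      (fun u e => by
        set V := ∑ j ∈ s, A i j • u j
        have e1 : ⟪V, e⟫ ^ 2 ≤ ‖V‖ ^ 2 * ‖e‖ ^ 2 := by
          have := real_inner_mul_inner_self_le V e
          rw [real_inner_self_eq_norm_sq, real_inner_self_eq_norm_sq] at this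
          rw [sq]; exact this
        have e2 : A i i ^ 2 * (‖e‖ ^ 2 - v) ^ 2 ≤ A i i ^ 2 * (‖e‖ ^ 4 + v ^ 2) := by
          gcongr
          nlinarith [mul_nonneg hv0 (sq_nonneg ‖e‖)]
        rw [inner_smul_left, conj_trivial]
        nlinarith [sq_nonneg (2 * ⟪V, e⟫ - A i i * (‖e‖ ^ 2 - v))]) (i0.add i1)
    have heq : ∀ ω, quadForm A (insert i s) (fun j => ε j ω) - v * ∑ j ∈ insert i s, A j j =
        quadForm A s (fun j => ε j ω) - c + (2 * ⟪∑ j ∈ s, A i j • ε j ω, ε i ω⟫ +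
        A i i * (‖ε i ω‖ ^ 2 - v)) := fun ω => by
      rw [quadForm_insert hA hi, Finset.sum_insert hi]
      ring
    simp_rw [heq]
    refine ⟨key.1, key.2.trans ?_⟩
    have e1 : ∫ ω, κ * (8 * ‖∑ j ∈ s, A i j • ε j ω‖ ^ 2 + 2 * A i i ^ 2 + 0) ∂P =
        κ * (8 * ∫ ω, ‖∑ j ∈ s, A i j • ε j ω‖ ^ 2 ∂P + 2 * A i i ^ 2) := by
      simp only [add_zero]
      rw [integral_const_mul, integral_add (hV.1.const_mul _) (integrable_const _),
        integral_const_mul, integral_const, probReal_univ, one_smul]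
    rw [integral_add i0 i1, integral_add ih.1 (integrable_const _), e1, integral_const,
      probReal_univ, one_smul, Finset.sum_insert hi]
    have h1 : κ * ∑ j ∈ s, A i j ^ 2 ≤ κ * A i i := by gcongr
    have h2 : κ * (8 * ∫ ω, ‖∑ j ∈ s, A i j • ε j ω‖ ^ 2 ∂P) ≤ κ * (8 * (κ * A i i)) := by
      gcongr
      exact hV.2.trans h1
    have h3 : A i i ^ 2 * v ^ 2 ≤ A i i * κ ^ 2 := by gcongr
    have h4 : κ * A i i ^ 2 ≤ κ ^ 2 * A i i := by
      calc κ * A i i ^ 2 ≤ (κ * κ) * A i i := by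
            gcongr
            nlinarith
        _ = _ := by ring
    linarith [ih.2]

/-- The third absolute moment of a centered quadratic form in the noise, of order `r ^ 3` for a
projection of rank at most `r ^ 2`. -/
theorem integral_abs_quadForm_sub_pow_three_le [Fintype ι] (h : IsNoise P ε v κ) {A : ι → ι → ℝ}
    (hA : ∀ i j, A i j = A j i) (hA2 : ∀ i, ∑ j, A i j ^ 2 ≤ A i i) {r : ℝ} (hr : 1 ≤ r)
    (htr : ∑ j, A j j ≤ r ^ 2) (s : Finset ι) :
    Integrable (fun ω => |quadForm A s (fun j => ε j ω) - v * ∑ j ∈ s, A j j| ^ 3) P ∧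
      ∫ ω, |quadForm A s (fun j => ε j ω) - v * ∑ j ∈ s, A j j| ^ 3 ∂P ≤
        400 * κ ^ 4 * r * ∑ j ∈ s, A j j := by
  induction s using Finset.induction_on with
  | empty => simp [quadForm]
  | insert i s hi ih =>
    have hκ := h.one_le i
    have hv := h.variance_le i
    have hv0 := h.variance_nonneg i
    have hAs : ∑ j ∈ s, A i j ^ 2 ≤ A i i :=
      (Finset.sum_le_univ_sum_of_nonneg fun _ => sq_nonneg _).trans (hA2 i)
    have hA0' : ∀ j, 0 ≤ A j j := fun j => (Finset.sum_nonneg fun _ _ => sq_nonneg _).trans (hA2 j)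
    have hA0 := hA0' i
    have hA1' : A i i ^ 2 ≤ A i i :=
      (Finset.single_le_sum (fun j _ => sq_nonneg (A i j)) (Finset.mem_univ i)).trans (hA2 i)
    have hA1 : A i i ≤ 1 := by nlinarith
    have hV := h.integral_norm_sum_smul_sq_le (A i) s
    have hV4 := h.integral_norm_sum_smul_pow_four_le (A i) s
    have hR := h.integral_quadForm_sub_sq_le hA hA2 s
    set c := v * ∑ j ∈ s, A j j
    set α := A i i
    -- Bounds on the conditional moments of the increment, with the cross term `|R| ‖V‖²` split by
    -- the arithmetic-geometric mean inequality at the scale `r` of `R` and `α` of `‖V‖²`.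
    set T : (ι → E) → ℝ := fun u => ((quadForm A s u - c) ^ 2 / r + r) / 2 with hT
    set W : (ι → E) → ℝ := fun u =>
      (α * (quadForm A s u - c) ^ 2 / r + r * ‖∑ j ∈ s, A i j • u j‖ ^ 4 / α) / 2 with hW
    have hr0 : 0 < r := by linarith
    have hT0 : ∀ u, 0 ≤ T u := fun u => by positivity
    have hW0 : ∀ u, 0 ≤ W u := fun u => by positivity
    have hRT : ∀ u, |quadForm A s u - c| ≤ T u := fun u => by
      have := abs_mul_le_div_add_div hr0 one_pos (quadForm A s u - c) 1
      simpa [hT] using this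
    have hRW : ∀ u, |quadForm A s u - c| * ‖∑ j ∈ s, A i j • u j‖ ^ 2 ≤ W u := fun u => by
      rcases hA0.eq_or_lt with h0 | h0
      -- When `α = 0`, row `i` of `A` and hence `V` vanish, and `W` has a summand `0 / 0 = 0`.
      · have hz : ∀ j ∈ s, A i j = 0 := by
          have := le_antisymm (hAs.trans h0.ge) (Finset.sum_nonneg fun _ _ => sq_nonneg _)
          intro j hj
          exact pow_eq_zero_iff two_ne_zero |>.1
            ((Finset.sum_eq_zero_iff_of_nonneg fun _ _ => sq_nonneg _).1 this j hj)
        have : ∑ j ∈ s, A i j • u j = 0 := Finset.sum_eq_zero fun j hj => by rw [hz j hj, zero_smul]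
        rw [this]
        simpa using hW0 u
      · have := abs_mul_le_div_add_div hr0 h0 (quadForm A s u - c) (‖∑ j ∈ s, A i j • u j‖ ^ 2)
        rwa [← pow_mul] at this
    have iT : Integrable (fun ω => T (fun j => ε j ω)) P :=
      ((hR.1.div_const r).add (integrable_const r)).div_const 2
    have iW : Integrable (fun ω => W (fun j => ε j ω)) P :=
      (((hR.1.const_mul α).div_const r).add ((hV4.1.const_mul r).div_const α)).div_const 2
    have htrs : ∑ j ∈ s, A j j ≤ r ^ 2 :=
      (Finset.sum_le_univ_sum_of_nonneg hA0').trans htr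
    have eT : ∫ ω, T (fun j => ε j ω) ∂P ≤ 7 * κ ^ 2 * r := by
      simp only [hT]
      rw [integral_div, integral_add (hR.1.div_const r) (integrable_const r), integral_div,
        integral_const, probReal_univ, one_smul]
      have h1 : (∫ ω, (quadForm A s (fun j => ε j ω) - c) ^ 2 ∂P) / r ≤ 12 * κ ^ 2 * r := by
        rw [div_le_iff₀ hr0]
        calc _ ≤ 12 * κ ^ 2 * ∑ j ∈ s, A j j := hR.2
          _ ≤ 12 * κ ^ 2 * r ^ 2 := by gcongr
          _ = _ := by ring
      have h2 : 1 * r ≤ κ ^ 2 * r := by gcongr; exact one_le_pow₀ hκ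
      linarith
    have eW : ∫ ω, W (fun j => ε j ω) ∂P ≤ 8 * κ ^ 2 * (r * α) := by
      simp only [hW]
      rw [integral_div, integral_add ((hR.1.const_mul α).div_const r)
        ((hV4.1.const_mul r).div_const α), integral_div, integral_div, integral_const_mul,
        integral_const_mul]
      have h1 : α * (∫ ω, (quadForm A s (fun j => ε j ω) - c) ^ 2 ∂P) / r ≤
          12 * κ ^ 2 * (r * α) := by
        rw [div_le_iff₀ hr0]
        calc _ ≤ α * (12 * κ ^ 2 * ∑ j ∈ s, A j j) := by gcongr; exact hR.2
          _ ≤ α * (12 * κ ^ 2 * r ^ 2) := by gcongr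
          _ = _ := by ring
      have h2 : r * (∫ ω, ‖∑ j ∈ s, A i j • ε j ω‖ ^ 4 ∂P) / α ≤ 4 * κ ^ 2 * (r * α) := by
        refine div_le_of_le_mul₀ hA0 (by positivity) ?_
        calc _ ≤ r * (4 * κ ^ 2 * (∑ j ∈ s, A i j ^ 2) ^ 2) := by gcongr; exact hV4.2
          _ ≤ r * (4 * κ ^ 2 * α ^ 2) := by
            gcongr
          _ = _ := by ring
      linarith
    clear_value T W
    have i0 : Integrable (fun ω => |quadForm A s (fun j => ε j ω) - c| ^ 3 +
        6 * α ^ 2 * v ^ 2 * T (fun j => ε j ω) + 4 * α ^ 3 * v ^ 3) P :=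
      (ih.1.add (iT.const_mul _)).add (integrable_const _)
    have k1 : Integrable (fun ω => 24 * W (fun j => ε j ω) + 16 * ‖∑ j ∈ s, A i j • ε j ω‖ ^ 2) P :=
      (iW.const_mul 24).add (hV.1.const_mul 16)
    have k2 : Integrable (fun ω => 6 * α ^ 2 * T (fun j => ε j ω) +
        16 * ‖∑ j ∈ s, A i j • ε j ω‖ ^ 4) P :=
      (iT.const_mul (6 * α ^ 2)).add (hV4.1.const_mul 16)
    have k3 : Integrable (fun ω => (24 * W (fun j => ε j ω) + 16 * ‖∑ j ∈ s, A i j • ε j ω‖ ^ 2) +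
        (6 * α ^ 2 * T (fun j => ε j ω) + 16 * ‖∑ j ∈ s, A i j • ε j ω‖ ^ 4)) P := k1.add k2
    have i1 : Integrable (fun ω => κ * ((24 * W (fun j => ε j ω) +
        16 * ‖∑ j ∈ s, A i j • ε j ω‖ ^ 2) + (6 * α ^ 2 * T (fun j => ε j ω) +
        16 * ‖∑ j ∈ s, A i j • ε j ω‖ ^ 4) + 4 * α ^ 3)) P :=
      (k3.add (integrable_const _)).const_mul κ
    have hQm := measurable_quadForm (E := E) A s
    have key := h.step hi
      (g := fun u e => |quadForm A s u - c + (2 * ⟪∑ j ∈ s, A i j • u j, e⟫ +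
        α * (‖e‖ ^ 2 - v))| ^ 3)
      (by fun_prop) (fun _ _ => by positivity)
      (b := fun u => |quadForm A s u - c| ^ 3 + 6 * α ^ 2 * v ^ 2 * T u + 4 * α ^ 3 * v ^ 3)
      (a := fun u => 3 * |quadForm A s u - c| * (quadForm A s u - c) * α)
      (c₂ := fun u => 24 * W u + 16 * ‖∑ j ∈ s, A i j • u j‖ ^ 2)
      (c₄ := fun u => 6 * α ^ 2 * T u + 16 * ‖∑ j ∈ s, A i j • u j‖ ^ 4) (c₆ := fun _ => 4 * α ^ 3)
      (w := fun u => (6 * |quadForm A s u - c| * (quadForm A s u - c)) • ∑ j ∈ s, A i j • u j)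
      (by simp [sum_smul_piecewise, quadForm_piecewise]) (by simp [quadForm_piecewise, hT])
      (by simp [sum_smul_piecewise, quadForm_piecewise, hW])
      (by simp [sum_smul_piecewise, quadForm_piecewise, hT])
      (fun _ => rfl) (fun u => by have := hW0 u; positivity)
      (fun u => by have := hT0 u; positivity) (fun _ => by positivity)
      (fun u e => by
        rw [inner_smul_left, conj_trivial]
        have := abs_add_increment_pow_three_le (∑ j ∈ s, A i j • u j) e hA0 hv0 (hRT u) (hRW u)
        linarith) (i0.add i1)
    have heq : ∀ ω, quadForm A (insert i s) (fun j => ε j ω) - v * ∑ j ∈ insert i s, A j j =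
        quadForm A s (fun j => ε j ω) - c + (2 * ⟪∑ j ∈ s, A i j • ε j ω, ε i ω⟫ +
        α * (‖ε i ω‖ ^ 2 - v)) := fun ω => by
      rw [quadForm_insert hA hi, Finset.sum_insert hi]
      ring
    simp_rw [heq]
    refine ⟨key.1, key.2.trans ?_⟩
    have e0 : ∫ ω, (|quadForm A s (fun j => ε j ω) - c| ^ 3 +
        6 * α ^ 2 * v ^ 2 * T (fun j => ε j ω) + 4 * α ^ 3 * v ^ 3) ∂P =
        ∫ ω, |quadForm A s (fun j => ε j ω) - c| ^ 3 ∂P +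
        6 * α ^ 2 * v ^ 2 * ∫ ω, T (fun j => ε j ω) ∂P + 4 * α ^ 3 * v ^ 3 := by
      have k4 : Integrable (fun ω => |quadForm A s (fun j => ε j ω) - c| ^ 3 +
          6 * α ^ 2 * v ^ 2 * T (fun j => ε j ω)) P := ih.1.add (iT.const_mul _)
      rw [integral_add k4 (integrable_const _), integral_add ih.1 (iT.const_mul _), integral_const_mul, integral_const, probReal_univ,
        one_smul]
    have e1 : ∫ ω, κ * ((24 * W (fun j => ε j ω) +
        16 * ‖∑ j ∈ s, A i j • ε j ω‖ ^ 2) + (6 * α ^ 2 * T (fun j => ε j ω) +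
        16 * ‖∑ j ∈ s, A i j • ε j ω‖ ^ 4) + 4 * α ^ 3) ∂P =
        κ * ((24 * ∫ ω, W (fun j => ε j ω) ∂P + 16 * ∫ ω, ‖∑ j ∈ s, A i j • ε j ω‖ ^ 2 ∂P) +
          (6 * α ^ 2 * ∫ ω, T (fun j => ε j ω) ∂P + 16 * ∫ ω, ‖∑ j ∈ s, A i j • ε j ω‖ ^ 4 ∂P) +
          4 * α ^ 3) := by
      rw [integral_const_mul, integral_add k3 (integrable_const _), integral_add k1 k2,
        integral_add (iW.const_mul 24) (hV.1.const_mul 16),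
        integral_add (iT.const_mul (6 * α ^ 2)) (hV4.1.const_mul 16)]
      simp only [integral_const_mul, integral_const, probReal_univ, one_smul]
    rw [integral_add i0 i1, e0, e1, Finset.sum_insert hi]
    have hκ0 : 0 ≤ κ := by linarith
    have hα3 : α ^ 3 ≤ r * α := by
      calc α ^ 3 ≤ α := pow_le_of_le_one hA0 hA1 (by norm_num)
        _ ≤ r * α := le_mul_of_one_le_left hA0 hr
    have hκ4 : ∀ k ≤ 4, κ ^ k * (r * α) ≤ κ ^ 4 * (r * α) := fun k hk => by gcongr
    have hET : 0 ≤ ∫ ω, T (fun j => ε j ω) ∂P := integral_nonneg fun _ => hT0 _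
    have g1 : α ^ 2 * v ^ 2 * ∫ ω, T (fun j => ε j ω) ∂P ≤ 7 * (κ ^ 4 * (r * α)) := by
      calc _ ≤ α * κ ^ 2 * (7 * κ ^ 2 * r) := by
            gcongr
        _ = _ := by ring
    have g2 : α ^ 3 * v ^ 3 ≤ κ ^ 4 * (r * α) := by
      calc _ ≤ (r * α) * κ ^ 3 := by gcongr
        _ ≤ _ := by rw [mul_comm]; exact hκ4 3 (by norm_num)
    have g3 : κ * ∫ ω, W (fun j => ε j ω) ∂P ≤ 8 * (κ ^ 4 * (r * α)) := by
      calc _ ≤ κ * (8 * κ ^ 2 * (r * α)) := by gcongr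
        _ = 8 * (κ ^ 3 * (r * α)) := by ring
        _ ≤ _ := by linarith [hκ4 3 (by norm_num)]
    have g4 : κ * ∫ ω, ‖∑ j ∈ s, A i j • ε j ω‖ ^ 2 ∂P ≤ κ ^ 4 * (r * α) := by
      calc _ ≤ κ * (κ * ∑ j ∈ s, A i j ^ 2) := by gcongr; exact hV.2
        _ ≤ κ * (κ * (1 * α)) := by gcongr; linarith
        _ ≤ κ * (κ * (r * α)) := by gcongr
        _ = κ ^ 2 * (r * α) := by ring
        _ ≤ _ := hκ4 2 (by norm_num)
    have g5 : κ * (α ^ 2 * ∫ ω, T (fun j => ε j ω) ∂P) ≤ 7 * (κ ^ 4 * (r * α)) := by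
      calc _ ≤ κ * (α * (7 * κ ^ 2 * r)) := by
            gcongr
        _ = 7 * (κ ^ 3 * (r * α)) := by ring
        _ ≤ _ := by linarith [hκ4 3 (by norm_num)]
    have g6 : κ * ∫ ω, ‖∑ j ∈ s, A i j • ε j ω‖ ^ 4 ∂P ≤ 4 * (κ ^ 4 * (r * α)) := by
      calc _ ≤ κ * (4 * κ ^ 2 * (∑ j ∈ s, A i j ^ 2) ^ 2) := by gcongr; exact hV4.2
        _ ≤ κ * (4 * κ ^ 2 * α ^ 2) := by gcongr
        _ ≤ κ * (4 * κ ^ 2 * (1 * α)) := by gcongr; linarith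
        _ ≤ κ * (4 * κ ^ 2 * (r * α)) := by gcongr
        _ = 4 * (κ ^ 3 * (r * α)) := by ring
        _ ≤ _ := by linarith [hκ4 3 (by norm_num)]
    have g7 : κ * α ^ 3 ≤ κ ^ 4 * (r * α) := by
      calc _ ≤ κ * (r * α) := by gcongr
        _ = κ ^ 1 * (r * α) := by ring
        _ ≤ _ := hκ4 1 (by norm_num)
    have hpos : 0 ≤ κ ^ 4 * (r * α) := by positivity
    linarith [ih.2]

end IsNoise
end Moments

/-! ### Penalized least squares over nested projections -/

theorem max_sub_le_pow_three_div {x t : ℝ} (hx : 0 ≤ x) (ht : 0 < t) :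
    max (x - t) 0 ≤ x ^ 3 / t ^ 2 := by
  rw [le_div_iff₀ (by positivity)]
  rcases le_total x t with h | h
  · rw [max_eq_right (by linarith), zero_mul]
    positivity
  · rw [max_eq_left (by linarith)]
    nlinarith [mul_nonneg hx (mul_nonneg (sub_nonneg.2 h) (add_nonneg hx ht.le)), pow_pos ht 3]

/-- The basic inequality of penalized least squares over a nested family `Q` of orthogonal
projections. The noise enters through the quadratic term `‖Q m' e‖²` and through a linear term, which
is normalized so that its size does not depend on `m'`. -/
theorem penalized_projection_inequality {G : Type*} [NormedAddCommGroup G] [InnerProductSpace ℝ G]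
    {Q : ℕ → G →ₗ[ℝ] G} (hsymm : ∀ m, (Q m).IsSymmetric)
    (hmul : ∀ a b x, Q a (Q b x) = Q (min a b) x) {F e : G} {m m' : ℕ} {p p' η : ℝ} (hη : 0 < η)
    (hsel : ‖F + e - Q m' (F + e)‖ ^ 2 + p' ≤ ‖F + e - Q m (F + e)‖ ^ 2 + p) :
    (1 - η) * ‖F - Q m' (F + e)‖ ^ 2 ≤ (1 + η) * ‖F - Q m F‖ ^ 2 + p - p' + 2 * ‖Q m' e‖ ^ 2 +
      ⟪Q m' F - Q m F, e⟫ ^ 2 / ‖Q m' F - Q m F‖ ^ 2 / η := by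
  have horth : ∀ k x y, ⟪x - Q k x, Q k y⟫ = 0 := fun k x y => by
    rw [← hsymm k, map_sub, hmul, min_self, sub_self, inner_zero_left]
  have hpyth : ∀ k x, ‖x - Q k x‖ ^ 2 + ‖Q k x‖ ^ 2 = ‖x‖ ^ 2 := fun k x => by
    have := norm_add_sq_real (x - Q k x) (Q k x)
    rw [horth, sub_add_cancel] at this
    linarith
  have hle : ∀ k x, ‖x - Q k x‖ ^ 2 ≤ ‖x‖ ^ 2 ∧ ‖Q k x‖ ^ 2 ≤ ‖x‖ ^ 2 := fun k x =>
    ⟨by nlinarith [hpyth k x], by nlinarith [hpyth k x]⟩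
  have hres : ∀ k, ‖F + e - Q k (F + e)‖ ^ 2 =
      ‖F - Q k F‖ ^ 2 + 2 * ⟪F - Q k F, e⟫ + ‖e‖ ^ 2 - ‖Q k e‖ ^ 2 := fun k => by
    have e1 : F + e - Q k (F + e) = (F - Q k F) + (e - Q k e) := by rw [map_add]; abel
    have := hpyth k e
    rw [e1, norm_add_sq_real, inner_sub_right, horth]
    linarith
  have hrisk : ‖F - Q m' (F + e)‖ ^ 2 = ‖F - Q m' F‖ ^ 2 + ‖Q m' e‖ ^ 2 := by
    have e1 : F - Q m' (F + e) = (F - Q m' F) - Q m' e := by rw [map_add]; abel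
    rw [e1, norm_sub_sq_real, horth]
    ring
  set u := Q m' F - Q m F with hu
  have hu2 : ‖u‖ ^ 2 ≤ ‖F - Q m' F‖ ^ 2 + ‖F - Q m F‖ ^ 2 := by
    rcases le_total m m' with hm | hm
    · have : u = Q m' (F - Q m F) := by rw [hu, map_sub, hmul, min_eq_right hm]
      rw [this]
      nlinarith [(hle m' (F - Q m F)).2, sq_nonneg ‖F - Q m' F‖]
    · have : u = -Q m (F - Q m' F) := by rw [hu, map_sub, hmul, min_eq_right hm, neg_sub]
      rw [this, norm_neg]
      nlinarith [(hle m (F - Q m' F)).2, sq_nonneg ‖F - Q m F‖]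
  have hlin : 2 * ⟪u, e⟫ ≤ η * ‖u‖ ^ 2 + ⟪u, e⟫ ^ 2 / ‖u‖ ^ 2 / η := by
    rcases eq_or_ne u 0 with h0 | h0
    · simp [h0]
    · have hu0 : 0 < ‖u‖ := norm_pos_iff.2 h0
      have e1 : η * ‖u‖ ^ 2 + ⟪u, e⟫ ^ 2 / ‖u‖ ^ 2 / η - 2 * ⟪u, e⟫ =
          (η * ‖u‖ ^ 2 - ⟪u, e⟫) ^ 2 / (‖u‖ ^ 2 * η) := by
        field_simp
        ring
      have : 0 ≤ (η * ‖u‖ ^ 2 - ⟪u, e⟫) ^ 2 / (‖u‖ ^ 2 * η) := by positivity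
      linarith
  have huin : ⟪u, e⟫ = ⟪F - Q m F, e⟫ - ⟪F - Q m' F, e⟫ := by
    rw [← inner_sub_left]
    congr 1
    rw [hu]
    abel
  rw [hres, hres] at hsel
  rw [hrisk]
  have h1 : η * ‖u‖ ^ 2 ≤ η * (‖F - Q m' F‖ ^ 2 + ‖F - Q m F‖ ^ 2) := by gcongr
  have h2 : 0 ≤ η * ‖Q m' e‖ ^ 2 := by positivity
  nlinarith [sq_nonneg ‖Q m e‖]

/-- The matrices of a nested family of orthogonal projections of rank at most `m`. -/
structure IsNestedProjection {ι : Type*} [Fintype ι] (A : ℕ → ι → ι → ℝ) : Prop where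
  symm : ∀ m i j, A m i j = A m j i
  mul : ∀ m l i j, ∑ k, A m i k * A l k j = A (min m l) i j
  trace_le : ∀ m, ∑ i, A m i i ≤ m

section Design

variable {E : Type*} [NormedAddCommGroup E] [InnerProductSpace ℝ E] {ι : Type*} [Fintype ι]

/-- The action of a real matrix on families of vectors: `(A u) i = ∑ k, A i k • u k`. -/
def matSmul (A : ι → ι → ℝ) (u : ι → E) (i : ι) : E := ∑ k, A i k • u k

/-- The action of a real matrix on families of vectors, on the Hilbert sum of copies of `E`. -/
noncomputable def matOp (E : Type*) [NormedAddCommGroup E] [InnerProductSpace ℝ E]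
    (A : ι → ι → ℝ) : PiLp 2 (fun _ : ι => E) →ₗ[ℝ] PiLp 2 (fun _ : ι => E) where
  toFun u := WithLp.toLp 2 (matSmul A u)
  map_add' u w := by
    ext i
    simp [matSmul, Finset.sum_add_distrib]
  map_smul' c u := by
    ext i
    simp [matSmul, Finset.smul_sum, smul_comm c]

/-- The amounts by which the noise terms exceed their shares of the penalty: for the quadratic terms,
which are monotone in the dimension, over dyadic dimensions only; for the normalized linear terms, with
coefficients `c m`, over all dimensions up to `N`. A linear term with `c m = 0` is `0 / 0 = 0`. -/
noncomputable def noiseExcess (A : ℕ → ι → ι → ℝ) (c : ℕ → ι → E) (v a η : ℝ) (N : ℕ) (u : ι → E) :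
    ℝ :=
  2 * ∑ k ∈ Finset.range N,
      max (quadForm (A (2 ^ (k + 1))) Finset.univ u - 2 * v * 2 ^ (k + 1)) 0 +
    ∑ m ∈ Finset.Icc 1 N, max ((∑ j, ⟪c m j, u j⟫) ^ 2 / (∑ j, ‖c m j‖ ^ 2) / η - a * m * v) 0

namespace IsNestedProjection

variable {A : ℕ → ι → ι → ℝ}

theorem matSmul_matSmul (hA : IsNestedProjection A) (m l : ℕ) (u : ι → E) :
    matSmul (A m) (matSmul (A l) u) = matSmul (A (min m l)) u := by
  funext i
  simp only [matSmul, Finset.smul_sum, smul_smul]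
  rw [Finset.sum_comm]
  simp_rw [← Finset.sum_smul, hA.mul]

theorem isSymmetric_matOp (hA : IsNestedProjection A) (m : ℕ) : (matOp E (A m)).IsSymmetric := by
  intro u w
  simp only [matOp, LinearMap.coe_mk, AddHom.coe_mk, PiLp.inner_apply, matSmul, sum_inner, inner_sum,
    inner_smul_left, inner_smul_right, conj_trivial]
  rw [Finset.sum_comm]
  simp_rw [hA.symm m]

theorem sum_norm_matSmul_sq (hA : IsNestedProjection A) (m : ℕ) (u : ι → E) :
    ∑ i, ‖matSmul (A m) u i‖ ^ 2 = quadForm (A m) Finset.univ u := by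
  have h := hA.isSymmetric_matOp (E := E) m (WithLp.toLp 2 u) (matOp E (A m) (WithLp.toLp 2 u))
  simp only [matOp, LinearMap.coe_mk, AddHom.coe_mk, PiLp.inner_apply, hA.matSmul_matSmul,
    min_self, real_inner_self_eq_norm_sq] at h
  rw [h, quadForm]
  simp only [matSmul, inner_sum, inner_smul_right]

/-- The quadratic terms increase with the dimension. -/
theorem quadForm_mono (hA : IsNestedProjection A) {m l : ℕ} (h : m ≤ l) (u : ι → E) :
    quadForm (A m) Finset.univ u ≤ quadForm (A l) Finset.univ u := by
  have e1 := norm_sub_sq_real (matOp E (A l) (WithLp.toLp 2 u)) (matOp E (A m) (WithLp.toLp 2 u))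
  have e2 : ⟪matOp E (A l) (WithLp.toLp 2 u), matOp E (A m) (WithLp.toLp 2 u)⟫ =
      ‖matOp E (A m) (WithLp.toLp 2 u)‖ ^ 2 := by
    rw [hA.isSymmetric_matOp l, ← real_inner_self_eq_norm_sq, hA.isSymmetric_matOp m]
    simp [matOp, hA.matSmul_matSmul, h]
  have e3 : ∀ k, ‖matOp E (A k) (WithLp.toLp 2 u)‖ ^ 2 = quadForm (A k) Finset.univ u := fun k => by
    rw [← hA.sum_norm_matSmul_sq, PiLp.norm_sq_eq_of_L2]
    rfl
  rw [e2, e3, e3] at e1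
  nlinarith [sq_nonneg ‖matOp E (A l) (WithLp.toLp 2 u) - matOp E (A m) (WithLp.toLp 2 u)‖]

theorem sum_norm_sub_matSmul_sq_le (hA : IsNestedProjection A) (m : ℕ) (u : ι → E) :
    ∑ i, ‖u i - matSmul (A m) u i‖ ^ 2 ≤ ∑ i, ‖u i‖ ^ 2 := by
  have h1 := hA.sum_norm_matSmul_sq m u
  have h2 : ∑ i, ⟪u i, matSmul (A m) u i⟫ = quadForm (A m) Finset.univ u := by
    simp only [matSmul, inner_sum, inner_smul_right, quadForm]
  have h3 : 0 ≤ ∑ i, ‖matSmul (A m) u i‖ ^ 2 := Finset.sum_nonneg fun _ _ => sq_nonneg _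
  simp_rw [norm_sub_sq_real]
  rw [Finset.sum_add_distrib, Finset.sum_sub_distrib, ← Finset.mul_sum, h2]
  linarith

/-- The oracle inequality of penalized least squares for fixed design, on every realization of the
noise `e`. -/
theorem oracle_inequality (hA : IsNestedProjection A) {F e : ι → E} {v δ η : ℝ} (hv : 0 ≤ v)
    (hη : 0 < η) {N m m' : ℕ} (hm' : m' ∈ Set.Icc 1 N)
    (hsel : ∑ i, ‖(F + e) i - matSmul (A m') (F + e) i‖ ^ 2 + 8 * (1 + δ) * v * m' ≤
      ∑ i, ‖(F + e) i - matSmul (A m) (F + e) i‖ ^ 2 + 8 * (1 + δ) * v * m) :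
    (1 - η) * ∑ i, ‖F i - matSmul (A m') (F + e) i‖ ^ 2 ≤
      (1 + η) * ∑ i, ‖F i - matSmul (A m) F i‖ ^ 2 + 8 * (1 + δ) * v * m +
      noiseExcess A (fun l => matSmul (A l) F - matSmul (A m) F) v (8 * δ) η N e := by
  have key := penalized_projection_inequality (G := PiLp 2 (fun _ : ι => E))
    (Q := fun m => matOp E (A m)) (F := WithLp.toLp 2 F) (e := WithLp.toLp 2 e) (m := m) (m' := m')
    (p := 8 * (1 + δ) * v * m) (p' := 8 * (1 + δ) * v * m') hA.isSymmetric_matOp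
    (fun a b x => by simp [matOp, hA.matSmul_matSmul]) hη
  simp only [matOp, LinearMap.coe_mk, AddHom.coe_mk, ← WithLp.toLp_add, ← WithLp.toLp_sub,
    PiLp.norm_sq_eq_of_L2, PiLp.inner_apply, Pi.sub_apply, hA.sum_norm_matSmul_sq] at key
  have key := key hsel
  -- The dyadic dimension `2 ^ (k + 1)` just above `m'` is at most `2 * m'`. So if the quadratic term
  -- in that dimension stays below `2 * v * 2 ^ (k + 1)`, twice the bound on its mean, its contribution
  -- is at most `8 * v * m'`, which leaves `8 * δ * v * m'` of the penalty for the linear term.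
  set k := Nat.log 2 m' with hk
  have hk1 : 2 ^ k ≤ m' := Nat.pow_log_le_self 2 (by have := hm'.1; omega)
  have hk2 : m' < 2 ^ (k + 1) := Nat.lt_pow_succ_log_self one_lt_two m'
  have hkN : k < N := (Nat.lt_two_pow_self).trans_le (hk1.trans hm'.2)
  have hk1' : (2 : ℝ) ^ k ≤ m' := by exact_mod_cast hk1
  have h1 := hA.quadForm_mono hk2.le e
  have h2 : max (quadForm (A (2 ^ (k + 1))) Finset.univ e - 2 * v * 2 ^ (k + 1)) 0 ≤
      ∑ k ∈ Finset.range N,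
        max (quadForm (A (2 ^ (k + 1))) Finset.univ e - 2 * v * 2 ^ (k + 1)) 0 :=
    Finset.single_le_sum
      (f := fun k => max (quadForm (A (2 ^ (k + 1))) Finset.univ e - 2 * v * 2 ^ (k + 1)) 0)
      (fun _ _ => le_max_right _ _) (Finset.mem_range.2 hkN)
  set c : ℕ → ι → E := fun l => matSmul (A l) F - matSmul (A m) F
  have h3 : max ((∑ j, ⟪c m' j, e j⟫) ^ 2 / (∑ j, ‖c m' j‖ ^ 2) / η - 8 * δ * m' * v) 0 ≤
      ∑ m ∈ Finset.Icc 1 N,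
        max ((∑ j, ⟪c m j, e j⟫) ^ 2 / (∑ j, ‖c m j‖ ^ 2) / η - 8 * δ * m * v) 0 :=
    Finset.single_le_sum
      (f := fun m => max ((∑ j, ⟪c m j, e j⟫) ^ 2 / (∑ j, ‖c m j‖ ^ 2) / η - 8 * δ * m * v) 0)
      (fun _ _ => le_max_right _ _) (Finset.mem_Icc.2 hm')
  have h4 := le_max_left (quadForm (A (2 ^ (k + 1))) Finset.univ e - 2 * v * 2 ^ (k + 1)) 0
  have h5 := le_max_left
    ((∑ j, ⟪c m' j, e j⟫) ^ 2 / (∑ j, ‖c m' j‖ ^ 2) / η - 8 * δ * m' * v) 0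
  have h6 : 2 * v * 2 ^ (k + 1) ≤ 4 * v * m' := by
    rw [pow_succ]
    nlinarith [mul_le_mul_of_nonneg_left hk1' hv]
  have hcm : ∀ j, c m' j = matSmul (A m') F j - matSmul (A m) F j := fun j => rfl
  simp only [← hcm] at key
  rw [noiseExcess]
  linarith

end IsNestedProjection

variable {Ω : Type*} [MeasurableSpace Ω] {P : Measure Ω} [IsProbabilityMeasure P]
  [MeasurableSpace E] [BorelSpace E] [SecondCountableTopology E] [CompleteSpace E]
  {ε : ι → Ω → E} {v κ : ℝ}

/-! ### The expected excess for a fixed design -/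

namespace IsNoise

/-- The bound is `0` when `v = 0`, as `400 * κ ^ 4 / 0 = 0`; the noise then vanishes. -/
theorem integral_quadForm_excess_le (h : IsNoise P ε v κ) {A : ι → ι → ℝ}
    (hA : ∀ i j, A i j = A j i) (hA2 : ∀ i, ∑ j, A i j ^ 2 ≤ A i i) {r : ℝ} (hr : 1 ≤ r)
    (htr : ∑ j, A j j ≤ r ^ 2) (hv : 0 ≤ v) :
    Integrable (fun ω => max (quadForm A Finset.univ (fun j => ε j ω) - 2 * v * r ^ 2) 0) P ∧
      ∫ ω, max (quadForm A Finset.univ (fun j => ε j ω) - 2 * v * r ^ 2) 0 ∂P ≤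
        400 * κ ^ 4 / v ^ 2 * r⁻¹ := by
  classical
  rcases hv.eq_or_lt with rfl | hv0
  · have : (fun ω => max (quadForm A Finset.univ (fun j => ε j ω) - 2 * 0 * r ^ 2) 0) =ᵐ[P]
        fun _ => 0 := by
      filter_upwards [h.ae_eq_zero] with ω hω
      simp [quadForm, hω]
    rw [integrable_congr this, integral_congr_ae this]
    simp
  have hR := h.integral_abs_quadForm_sub_pow_three_le hA hA2 hr htr Finset.univ
  set R : Ω → ℝ := fun ω => quadForm A Finset.univ (fun j => ε j ω) - v * ∑ j, A j j with hRdef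
  have hr0 : 0 < r := by linarith
  have hle : ∀ ω, max (quadForm A Finset.univ (fun j => ε j ω) - 2 * v * r ^ 2) 0 ≤
      |R ω| ^ 3 / (v * r ^ 2) ^ 2 := fun ω => by
    refine le_trans (max_le_max ?_ le_rfl) (max_sub_le_pow_three_div (abs_nonneg (R ω))
      (by positivity : 0 < v * r ^ 2))
    have h1 := le_abs_self (R ω)
    have h2 := mul_le_mul_of_nonneg_left htr hv
    simp only [hRdef] at h1 ⊢
    linarith
  have hm : Measurable fun ω => max (quadForm A Finset.univ (fun j => ε j ω) - 2 * v * r ^ 2) 0 :=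
    (((measurable_quadForm A Finset.univ).comp (measurable_pi_lambda _ h.measurable)).sub_const
      _).max measurable_const
  have hi := (hR.1.div_const ((v * r ^ 2) ^ 2)).mono' hm.aestronglyMeasurable
    (Filter.Eventually.of_forall fun ω => by
      rw [Real.norm_of_nonneg (le_max_right _ _)]
      exact hle ω)
  refine ⟨hi, (integral_mono hi (hR.1.div_const _) hle).trans ?_⟩
  rw [integral_div, div_le_iff₀ (by positivity)]
  refine hR.2.trans ?_
  calc 400 * κ ^ 4 * r * ∑ j, A j j ≤ 400 * κ ^ 4 * r * r ^ 2 := by gcongr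
    _ = _ := by field_simp

/-- The bound is `0` when `v = 0`, as it has denominator `0`; the noise then vanishes. -/
theorem integral_linear_excess_le (h : IsNoise P ε v κ) (c : ι → E) {a η : ℝ} (ha : 0 < a)
    (hη : 0 < η) (hv : 0 ≤ v) :
    Integrable (fun ω => max ((∑ j, ⟪c j, ε j ω⟫) ^ 2 / (∑ j, ‖c j‖ ^ 2) / η - a * v) 0) P ∧
      ∫ ω, max ((∑ j, ⟪c j, ε j ω⟫) ^ 2 / (∑ j, ‖c j‖ ^ 2) / η - a * v) 0 ∂P ≤
        Real.exp (57 * κ) / (η ^ 3 * (a * v) ^ 2) := by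
  classical
  rcases hv.eq_or_lt with rfl | hv0
  · have : (fun ω => max ((∑ j, ⟪c j, ε j ω⟫) ^ 2 / (∑ j, ‖c j‖ ^ 2) / η - a * 0) 0) =ᵐ[P]
        fun _ => 0 := by
      filter_upwards [h.ae_eq_zero] with ω hω
      simp [hω]
    rw [integrable_congr this, integral_congr_ae this]
    simp
  set B := ∑ j, ‖c j‖ ^ 2 with hB
  have hB0 : 0 ≤ B := Finset.sum_nonneg fun _ _ => sq_nonneg _
  have hL := h.integral_sum_inner_pow_six_le (c := fun j => (√B)⁻¹ • c j) (s := Finset.univ) (by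
    simp_rw [norm_smul, mul_pow]
    rw [← Finset.mul_sum, ← hB, norm_inv, Real.norm_of_nonneg (Real.sqrt_nonneg _), inv_pow,
      Real.sq_sqrt hB0]
    exact inv_mul_le_one)
  have hle : ∀ ω, max ((∑ j, ⟪c j, ε j ω⟫) ^ 2 / B / η - a * v) 0 ≤
      (∑ j, ⟪(√B)⁻¹ • c j, ε j ω⟫) ^ 6 / (η ^ 3 * (a * v) ^ 2) := fun ω => by
    refine (max_sub_le_pow_three_div (by positivity) (by positivity)).trans_eq ?_
    have hB6 : √B ^ 6 = B ^ 3 := by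
      calc √B ^ 6 = (√B ^ 2) ^ 3 := by ring
        _ = B ^ 3 := by rw [Real.sq_sqrt hB0]
    have e1 : (∑ j, ⟪(√B)⁻¹ • c j, ε j ω⟫) ^ 6 = (∑ j, ⟪c j, ε j ω⟫) ^ 6 / B ^ 3 := by
      simp_rw [inner_smul_left, conj_trivial]
      rw [← Finset.mul_sum, mul_pow, inv_pow, hB6, inv_mul_eq_div]
    rw [e1, div_pow, div_pow, ← pow_mul, div_div, div_div]
  have hεm := h.measurable
  have hm : Measurable fun ω => max ((∑ j, ⟪c j, ε j ω⟫) ^ 2 / B / η - a * v) 0 := by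
    fun_prop
  have hi := (hL.1.div_const (η ^ 3 * (a * v) ^ 2)).mono' hm.aestronglyMeasurable
    (Filter.Eventually.of_forall fun ω => by
      rw [Real.norm_of_nonneg (le_max_right _ _)]
      exact hle ω)
  refine ⟨hi, (integral_mono hi (hL.1.div_const _) hle).trans ?_⟩
  rw [integral_div]
  gcongr
  exact hL.2

end IsNoise

/-- The bound on the expected excess: a convergent geometric series for the quadratic terms and a
convergent series of inverse squares for the linear ones. -/
noncomputable def excessBound (v κ a η : ℝ) : ℝ :=
  2 * (400 * κ ^ 4 / v ^ 2 * ∑' k : ℕ, (√2)⁻¹ ^ k) +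
    Real.exp (57 * κ) / (η ^ 3 * (a * v) ^ 2) * ∑' m : ℕ, ((m : ℝ) ^ 2)⁻¹

theorem IsNoise.integral_noiseExcess_le (h : IsNoise P ε v κ) (hv : 0 ≤ v) {A : ℕ → ι → ι → ℝ}
    (hA : IsNestedProjection A) (c : ℕ → ι → E) {a η : ℝ} (ha : 0 < a) (hη : 0 < η) (N : ℕ) :
    Integrable (fun ω => noiseExcess A c v a η N (fun j => ε j ω)) P ∧
      ∫ ω, noiseExcess A c v a η N (fun j => ε j ω) ∂P ≤ excessBound v κ a η := by
  have hdiag : ∀ m i, ∑ j, A m i j ^ 2 ≤ A m i i := fun m i => by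
    have := hA.mul m m i i
    rw [min_self] at this
    rw [← this]
    exact Finset.sum_le_sum fun j _ => by rw [hA.symm m j i, sq]
  have hq : ∀ k : ℕ, _ := fun k => h.integral_quadForm_excess_le (hA.symm (2 ^ (k + 1)))
    (hdiag (2 ^ (k + 1))) (r := √2 ^ (k + 1)) (one_le_pow₀ (by simp [Real.one_le_sqrt]))
    (by
      refine (hA.trace_le _).trans_eq ?_
      rw [← pow_mul, mul_comm, pow_mul, Real.sq_sqrt zero_le_two]
      simp) hv
  have hsq : ∀ k : ℕ, (√2 ^ (k + 1)) ^ 2 = (2 : ℝ) ^ (k + 1) := fun k => by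
    rw [← pow_mul, mul_comm, pow_mul, Real.sq_sqrt zero_le_two]
  simp only [hsq] at hq
  have hl : ∀ m ∈ Finset.Icc 1 N, _ := fun m hm =>
    h.integral_linear_excess_le (c m) (a := a * m) (η := η)
      (by have := (Finset.mem_Icc.1 hm).1; positivity) hη hv
  have i1 := integrable_finsetSum (Finset.range N) fun k _ => (hq k).1
  have i2 := integrable_finsetSum (Finset.Icc 1 N) fun m hm => (hl m hm).1
  refine ⟨(i1.const_mul 2).add i2, ?_⟩
  unfold noiseExcess excessBound
  rw [integral_add (i1.const_mul 2) i2, integral_const_mul, integral_finsetSum _ fun k _ => (hq k).1,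
    integral_finsetSum _ fun m hm => (hl m hm).1]
  have h2 : 1 < √2 := by rw [Real.lt_sqrt zero_le_one]; norm_num
  gcongr
  · calc _ ≤ ∑ k ∈ Finset.range N, 400 * κ ^ 4 / v ^ 2 * (√2)⁻¹ ^ k := by
          refine Finset.sum_le_sum fun k _ => (hq k).2.trans ?_
          rw [inv_pow]
          gcongr
          · exact h2.le
          · omega
      _ ≤ _ := by
          rw [← Finset.mul_sum]
          gcongr
          exact (summable_geometric_of_lt_one (by positivity) (inv_lt_one_of_one_lt₀ h2)).sum_le_tsum
            _ fun _ _ => by positivity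
  · calc _ ≤ ∑ m ∈ Finset.Icc 1 N, Real.exp (57 * κ) / (η ^ 3 * (a * v) ^ 2) * ((m : ℝ) ^ 2)⁻¹ := by
          refine Finset.sum_le_sum fun m hm => (hl m hm).2.trans_eq ?_
          rw [← div_eq_mul_inv, div_div]
          ring
      _ ≤ _ := by
          rw [← Finset.mul_sum]
          gcongr
          exact (Real.summable_nat_pow_inv.2 one_lt_two).sum_le_tsum _ fun _ _ => by positivity

end Design

/-! ### Functional linear regression as a fixed-design problem -/

variable {n : ℕ}

theorem empEigenvalue_eq (x : Fin n → H) (φ : HilbertBasis ℕ ℝ H) (j : ℕ) :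
    empEigenvalue x φ j = (n : ℝ)⁻¹ * ∑ i, ⟪φ j, x i⟫ ^ 2 := by
  simp only [empEigenvalue, empCov_apply, inner_smul_right, inner_sum, sq, real_inner_comm (φ j)]

theorem measurable_hatMatrix {φ : (Fin n → H) → HilbertBasis ℕ ℝ H}
    (hφ : ∀ j, Measurable fun x => φ x j) (m : ℕ) (i k : Fin n) :
    Measurable fun x => hatMatrix x (φ x) m i k := by
  simp only [hatMatrix, empEigenvalue_eq]
  fun_prop

namespace IsEmpPCABasis

variable {x : Fin n → H} {φ : HilbertBasis ℕ ℝ H}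

theorem isNestedProjection (h : IsEmpPCABasis x φ) (hn : 1 ≤ n) :
    IsNestedProjection (hatMatrix x φ) where
  symm := hatMatrix_symm x φ
  mul := h.sum_hatMatrix_mul hn
  trace_le := h.sum_hatMatrix_diag_le hn

theorem empNormSq_sub_projOp (h : IsEmpPCABasis x φ) (hn : 1 ≤ n) (m : ℕ) (K : HKer) :
    empNormSq x (integralOp K - projOp φ m K) =
      (n : ℝ)⁻¹ * ∑ i, ‖integralOp K (x i) -
        matSmul (hatMatrix x φ m) (fun k => integralOp K (x k)) i‖ ^ 2 := by
  simp only [empNormSq, sub_apply, h.projOp_apply_eq hn, matSmul]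

end IsEmpPCABasis

theorem empNormSq_sub_slopeEst (x y : Fin n → H) (φ : HilbertBasis ℕ ℝ H) (m : ℕ) (K : HKer) :
    empNormSq x (integralOp K - slopeEst x y φ m) =
      (n : ℝ)⁻¹ * ∑ i, ‖integralOp K (x i) - matSmul (hatMatrix x φ m) y i‖ ^ 2 := by
  simp only [empNormSq, sub_apply, slopeEst_apply_eq, matSmul]

theorem contrast_slopeEst (x y : Fin n → H) (φ : HilbertBasis ℕ ℝ H) (m : ℕ) :
    contrast x y (slopeEst x y φ m) =
      (n : ℝ)⁻¹ * ∑ i, ‖y i - matSmul (hatMatrix x φ m) y i‖ ^ 2 := by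
  simp only [contrast, slopeEst_apply_eq, matSmul]

/-! ### The risk for a random design -/

variable {Ω : Type*} [MeasurableSpace Ω] {P : Measure Ω} {X ε : Fin n → Ω → H} {σsq : ℝ}

theorem pow_le_one_add_rpow {t p : ℝ} (ht : 0 ≤ t) {k : ℕ} (hk : (k : ℝ) ≤ p) :
    t ^ k ≤ 1 + t ^ p := by
  rcases le_total t 1 with h | h
  · have := pow_le_one₀ ht h (n := k)
    have := Real.rpow_nonneg ht p
    linarith
  · have := Real.rpow_le_rpow_of_exponent_le h hk
    rw [Real.rpow_natCast] at this
    linarith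

namespace IsDesignNoise

theorem memLp_response (h : IsDesignNoise P X ε σsq) (K : HKer) (i : Fin n) :
    MemLp (fun ω => response K X ε i ω) 2 P :=
  ((integralOp K).comp_memLp' (h.memLp_X i)).add (h.memLp_noise i)

theorem measurable_hatMatrix_design (h : IsDesignNoise P X ε σsq)
    {φ : (Fin n → H) → HilbertBasis ℕ ℝ H} (hφm : ∀ j, Measurable fun x => φ x j) (m : ℕ)
    (i k : Fin n) :
    Measurable fun ω => hatMatrix (fun i => X i ω) (φ fun i => X i ω) m i k :=
  (measurable_hatMatrix hφm m i k).comp (measurable_pi_lambda _ h.measurable_X)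

theorem integrable_empNormSq_sub_projOp (h : IsDesignNoise P X ε σsq) (hn : 1 ≤ n)
    {φ : (Fin n → H) → HilbertBasis ℕ ℝ H} (hφ : ∀ x, IsEmpPCABasis x (φ x))
    (hφm : ∀ j, Measurable fun x => φ x j) (K : HKer) (m : ℕ) :
    Integrable (fun ω => empNormSq (fun i => X i ω)
      (integralOp K - projOp (φ fun i => X i ω) m K)) P := by
  have hhat := h.measurable_hatMatrix_design hφm
  have hK : Measurable (integralOp K) := (integralOp K).continuous.measurable
  have hXm := h.measurable_X
  have hFi : ∀ i, Integrable (fun ω => ‖integralOp K (X i ω)‖ ^ 2) P := fun i =>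
    ((integralOp K).comp_memLp' (h.memLp_X i)).integrable_norm_pow two_ne_zero
  simp only [(hφ _).empNormSq_sub_projOp hn]
  refine Integrable.const_mul ?_ _
  refine (integrable_finsetSum Finset.univ fun i _ => hFi i).mono' ?_
    (Filter.Eventually.of_forall fun ω => ?_)
  · simp only [matSmul]
    exact Measurable.aestronglyMeasurable (by fun_prop)
  · rw [Real.norm_of_nonneg (Finset.sum_nonneg fun _ _ => sq_nonneg _)]
    exact ((hφ fun i => X i ω).isNestedProjection hn).sum_norm_sub_matSmul_sq_le m
      (fun k => integralOp K (X k ω))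

/-- The risk is dominated by the squared norms of the responses and of the noise, whatever `mhat`. -/
theorem integrable_empNormSq_sub_slopeEst (h : IsDesignNoise P X ε σsq) (hn : 1 ≤ n)
    {φ : (Fin n → H) → HilbertBasis ℕ ℝ H} (hφ : ∀ x, IsEmpPCABasis x (φ x))
    (hφm : ∀ j, Measurable fun x => φ x j) (K : HKer) {mhat : Ω → ℕ} (hm : Measurable mhat) :
    Integrable (fun ω => empNormSq (fun i => X i ω) (integralOp K -
      slopeEst (fun i => X i ω) (fun i => response K X ε i ω) (φ fun i => X i ω) (mhat ω))) P := by
  have hhat := h.measurable_hatMatrix_design hφm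
  have hK : Measurable (integralOp K) := (integralOp K).continuous.measurable
  have hXm := h.measurable_X
  have hεm := h.measurable_noise
  have hYi : ∀ i, Integrable (fun ω => ‖response K X ε i ω‖ ^ 2) P := fun i =>
    (h.memLp_response K i).integrable_norm_pow two_ne_zero
  have hεi : ∀ i, Integrable (fun ω => ‖ε i ω‖ ^ 2) P := fun i =>
    (h.memLp_noise i).integrable_norm_pow two_ne_zero
  simp only [empNormSq_sub_slopeEst]
  refine Integrable.const_mul ?_ _
  have hdom := ((integrable_finsetSum Finset.univ fun i _ => hYi i).const_mul 2).add
    ((integrable_finsetSum Finset.univ fun i _ => hεi i).const_mul 2)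
  refine hdom.mono' ?_ (Filter.Eventually.of_forall fun ω => ?_)
  · have : Measurable fun q : ℕ × Ω => ∑ i, ‖integralOp K (X i q.2) -
        matSmul (hatMatrix (fun i => X i q.2) (φ fun i => X i q.2) q.1)
          (fun i => response K X ε i q.2) i‖ ^ 2 := by
      refine measurable_from_prod_countable_right fun m => ?_
      simp only [matSmul, response]
      fun_prop
    exact (this.comp (hm.prodMk measurable_id)).aestronglyMeasurable
  · rw [Real.norm_of_nonneg (Finset.sum_nonneg fun _ _ => sq_nonneg _)]
    set w := matSmul (hatMatrix (fun i => X i ω) (φ fun i => X i ω) (mhat ω))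
      (fun i => response K X ε i ω) with hw
    have h1 : ∑ i, ‖response K X ε i ω - w i‖ ^ 2 ≤ ∑ i, ‖response K X ε i ω‖ ^ 2 :=
      ((hφ fun i => X i ω).isNestedProjection hn).sum_norm_sub_matSmul_sq_le (mhat ω)
        (fun i => response K X ε i ω)
    have h2 : ∀ i, ‖integralOp K (X i ω) - w i‖ ^ 2 ≤
        2 * ‖response K X ε i ω - w i‖ ^ 2 + 2 * ‖ε i ω‖ ^ 2 := fun i => by
      have e1 : integralOp K (X i ω) - w i = (response K X ε i ω - w i) - ε i ω := by
        rw [response]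
        abel
      have e2 := parallelogram_law_with_norm ℝ (response K X ε i ω - w i) (ε i ω)
      rw [e1]
      nlinarith [sq_nonneg ‖response K X ε i ω - w i + ε i ω‖]
    refine (Finset.sum_le_sum fun i _ => h2 i).trans ?_
    rw [Finset.sum_add_distrib, ← Finset.mul_sum, ← Finset.mul_sum]
    simp only [Pi.add_apply]
    gcongr

variable [IsProbabilityMeasure P]

theorem isNoise (h : IsDesignNoise P X ε σsq) {p τ : ℝ} (hp : 6 < p)
    (hi : ∀ i, Integrable (fun ω => ‖ε i ω‖ ^ p) P) (hτ : ∀ i, ∫ ω, ‖ε i ω‖ ^ p ∂P = τ) :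
    IsNoise P ε σsq (1 + τ) := by
  have hle : ∀ k ≤ 6, ∀ i ω, ‖ε i ω‖ ^ k ≤ 1 + ‖ε i ω‖ ^ p := fun k hk i ω =>
    pow_le_one_add_rpow (norm_nonneg _) (by
      have : (k : ℝ) ≤ 6 := by exact_mod_cast hk
      linarith)
  have hint : ∀ i, Integrable (fun ω => 1 + ‖ε i ω‖ ^ p) P := fun i => (integrable_const 1).add (hi i)
  have hpow : ∀ i, ∀ k ≤ 6, Integrable (fun ω => ‖ε i ω‖ ^ k) P := fun i k hk =>
    (hint i).mono' ((h.measurable_noise i).norm.pow_const k).aestronglyMeasurable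
      (Filter.Eventually.of_forall fun ω => by
        rw [Real.norm_of_nonneg (by positivity)]
        exact hle k hk i ω)
  refine ⟨h.measurable_noise, h.iIndep.comp (fun _ => Prod.snd) fun _ => measurable_snd,
    h.mean_noise, h.variance_noise, hpow, fun i k hk => ?_⟩
  refine (integral_mono (hpow i k hk) (hint i) (hle k hk i)).trans_eq ?_
  rw [integral_add (integrable_const 1) (hi i), hτ]
  simp

/-- The whole design is independent of the whole noise. -/
theorem indepFun_design_noise (h : IsDesignNoise P X ε σsq) :
    IndepFun (fun ω i => X i ω) (fun ω i => ε i ω) P := by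
  have hX : ∀ i, AEMeasurable (X i) P := fun i => (h.measurable_X i).aemeasurable
  have hε : ∀ i, AEMeasurable (ε i) P := fun i => (h.measurable_noise i).aemeasurable
  have hXε : ∀ i, Measurable fun ω => (X i ω, ε i ω) := fun i =>
    (h.measurable_X i).prodMk (h.measurable_noise i)
  have iX : iIndepFun X P := h.iIndep.comp (fun _ => Prod.fst) fun _ => measurable_fst
  have iε : iIndepFun ε P := h.iIndep.comp (fun _ => Prod.snd) fun _ => measurable_snd
  have pX : ∀ i, IsProbabilityMeasure (P.map (X i)) := fun i =>
    Measure.isProbabilityMeasure_map (hX i)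
  have pε : ∀ i, IsProbabilityMeasure (P.map (ε i)) := fun i =>
    Measure.isProbabilityMeasure_map (hε i)
  rw [indepFun_iff_map_prod_eq_prod_map_map (aemeasurable_pi_lambda _ hX)
    (aemeasurable_pi_lambda _ hε), (iIndepFun_iff_map_fun_eq_pi_map hX).1 iX,
    (iIndepFun_iff_map_fun_eq_pi_map hε).1 iε]
  have e1 := (iIndepFun_iff_map_fun_eq_pi_map fun i => (hXε i).aemeasurable).1 h.iIndep
  have e2 : ∀ i, P.map (fun ω => (X i ω, ε i ω)) = (P.map (X i)).prod (P.map (ε i)) := fun i =>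
    (indepFun_iff_map_prod_eq_prod_map_map (hX i) (hε i)).1 (h.indep i)
  simp_rw [e2] at e1
  have mp := measurePreserving_arrowProdEquivProdArrow H H (Fin n) (fun i => P.map (X i))
    (fun i => P.map (ε i))
  rw [← mp.map_eq, ← e1, Measure.map_map mp.measurable (measurable_pi_lambda _ hXε)]
  rfl

/-- The expected excess of the noise terms, the design being random. -/
theorem integral_noiseExcess_le (h : IsDesignNoise P X ε σsq) {κ : ℝ} (hε : IsNoise P ε σsq κ)
    (hσ : 0 ≤ σsq) {A : (Fin n → H) → ℕ → Fin n → Fin n → ℝ}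
    (hA : ∀ x, IsNestedProjection (A x)) (hAm : ∀ m i k, Measurable fun x => A x m i k)
    {c : (Fin n → H) → ℕ → Fin n → H} (hc : ∀ m i, Measurable fun x => c x m i) {a η : ℝ}
    (ha : 0 < a) (hη : 0 < η) (N : ℕ) :
    Integrable (fun ω => noiseExcess (A (fun i => X i ω)) (c (fun i => X i ω)) σsq a η N
      (fun i => ε i ω)) P ∧
    ∫ ω, noiseExcess (A (fun i => X i ω)) (c (fun i => X i ω)) σsq a η N (fun i => ε i ω) ∂P ≤
      excessBound σsq κ a η := by
  have key := integrable_and_integral_le_of_indepFun (measurable_pi_lambda _ h.measurable_X)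
    (measurable_pi_lambda _ h.measurable_noise) h.indepFun_design_noise
    (g := fun x e => noiseExcess (A x) (c x) σsq a η N e) (h := fun _ => excessBound σsq κ a η)
    (by unfold noiseExcess quadForm Function.uncurry; fun_prop)
    (fun x e => by unfold noiseExcess; positivity)
    (fun x => (hε.integral_noiseExcess_le hσ (hA x) (c x) ha hη N).1)
    (fun x => (hε.integral_noiseExcess_le hσ (hA x) (c x) ha hη N).2) (integrable_const _)
  simpa using key

/-- The oracle inequality for a single model `m`, before `η` is chosen: integrate the fixed-design
oracle inequality, whose noise terms have mean `O(1)` uniformly in the design. -/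
theorem integral_empNormSq_le (h : IsDesignNoise P X ε σsq) (hn : 1 ≤ n) {κ : ℝ}
    (hε : IsNoise P ε σsq κ)
    {φ : (Fin n → H) → HilbertBasis ℕ ℝ H} (hφ : ∀ x, IsEmpPCABasis x (φ x))
    (hφm : ∀ j, Measurable fun x => φ x j) (K : HKer) {mhat : Ω → ℕ} (hmm : Measurable mhat)
    {δ η : ℝ} (hδ : 0 < δ) (hη : 0 < η) {N m : ℕ} (hm : m ∈ Set.Icc 1 N)
    (hsel : ∀ ω, IsSelected (fun i => X i ω) (fun i => response K X ε i ω) (φ fun i => X i ω)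
      δ σsq N (mhat ω)) :
    (1 - η) * ∫ ω, empNormSq (fun i => X i ω) (integralOp K - slopeEst (fun i => X i ω)
        (fun i => response K X ε i ω) (φ fun i => X i ω) (mhat ω)) ∂P ≤
      (1 + η) * ∫ ω, empNormSq (fun i => X i ω) (integralOp K - projOp (φ fun i => X i ω) m K) ∂P +
        pen n δ σsq m + excessBound σsq κ (8 * δ) η / n := by
  have hn0 : (0 : ℝ) < n := by exact_mod_cast hn
  have hσ := hε.variance_nonneg ⟨0, hn⟩
  have hproj : ∀ x, IsNestedProjection (hatMatrix x (φ x)) := fun x => (hφ x).isNestedProjection hn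
  have hhat := measurable_hatMatrix hφm
  have hK : Measurable (integralOp K) := (integralOp K).continuous.measurable
  have hex := h.integral_noiseExcess_le hε hσ hproj hhat (a := 8 * δ) (η := η)
    (c := fun x l => matSmul (hatMatrix x (φ x) l) (fun k => integralOp K (x k)) -
      matSmul (hatMatrix x (φ x) m) (fun k => integralOp K (x k)))
    (fun l i => by simp only [matSmul, Pi.sub_apply]; fun_prop) (by positivity) hη N
  set T : Ω → ℝ := fun ω => noiseExcess (hatMatrix (fun i => X i ω) (φ fun i => X i ω))
    (fun l => matSmul (hatMatrix (fun i => X i ω) (φ fun i => X i ω) l)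
      (fun k => integralOp K (X k ω)) - matSmul (hatMatrix (fun i => X i ω) (φ fun i => X i ω) m)
        (fun k => integralOp K (X k ω))) σsq (8 * δ) η N (fun i => ε i ω) with hT
  have hL := h.integrable_empNormSq_sub_slopeEst hn hφ hφm K hmm
  have hb := h.integrable_empNormSq_sub_projOp hn hφ hφm K m
  have hpath : ∀ ω, (1 - η) * empNormSq (fun i => X i ω) (integralOp K - slopeEst (fun i => X i ω)
        (fun i => response K X ε i ω) (φ fun i => X i ω) (mhat ω)) ≤
      (1 + η) * empNormSq (fun i => X i ω) (integralOp K - projOp (φ fun i => X i ω) m K) +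
        (pen n δ σsq m + (n : ℝ)⁻¹ * T ω) := fun ω => by
    obtain ⟨hmem, hmin⟩ := hsel ω
    have h1 := hmin m hm
    rw [contrast_slopeEst, contrast_slopeEst] at h1
    have hpen : ∀ k : ℕ, pen n δ σsq k = (n : ℝ)⁻¹ * (8 * (1 + δ) * σsq * k) := fun k => by
      rw [pen, inv_mul_eq_div]
    rw [hpen, hpen, ← mul_add, ← mul_add, mul_le_mul_iff_right₀ (inv_pos.2 hn0)] at h1
    have h2 := (hproj fun i => X i ω).oracle_inequality (F := fun i => integralOp K (X i ω))
      (e := fun i => ε i ω) hσ hη hmem h1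
    rw [empNormSq_sub_slopeEst, (hφ _).empNormSq_sub_projOp hn, hpen]
    have h3 := mul_le_mul_of_nonneg_left h2 (inv_pos.2 hn0).le
    refine le_trans (le_of_eq ?_) (h3.trans (le_of_eq ?_))
    · simp only [response, Pi.add_def]
      ring
    · simp only [hT]
      ring
  have iT : Integrable (fun ω => pen n δ σsq m + (n : ℝ)⁻¹ * T ω) P :=
    (integrable_const _).add (hex.1.const_mul _)
  have key := integral_mono (hL.const_mul (1 - η)) ((hb.const_mul (1 + η)).add iT) hpath
  simp only [Pi.add_apply] at key
  rw [integral_const_mul, integral_add (hb.const_mul _) iT, integral_const_mul,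
    integral_add (integrable_const _) (hex.1.const_mul _), integral_const, probReal_univ, one_smul,
    integral_const_mul] at key
  refine key.trans ?_
  rw [← add_assoc, div_eq_inv_mul]
  gcongr
  exact hex.2

end IsDesignNoise

end FunLin

theorem mainTheorem2 (p : ℝ) (hp : 6 < p) (δ : ℝ) (hδ : 0 < δ) (ζ : ℝ) (hζ : 0 < ζ) (σsq τ : ℝ) :
    ∃ C' : ℝ, 0 < C' ∧
      ∀ {Ω : Type*} [MeasurableSpace Ω] (P : Measure Ω) [IsProbabilityMeasure P]
        (n N : ℕ) (_ : 1 ≤ n) (_ : 1 ≤ N) (_ : (N : ℝ) * Real.log n ^ 2 ≤ n)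
        (K : FunLin.HKer) (X ε : Fin n → Ω → FunLin.H)
        (_ : FunLin.IsDesignNoise P X ε σsq)
        (_ : ∀ i, Integrable (fun ω => ‖ε i ω‖ ^ p) P)
        (_ : ∀ i, ∫ ω, ‖ε i ω‖ ^ p ∂P = τ)
        (φ : (Fin n → FunLin.H) → HilbertBasis ℕ ℝ FunLin.H)
        (_ : ∀ x, FunLin.IsEmpPCABasis x (φ x))
        (_ : ∀ j, Measurable (fun x => φ x j))
        (mhat : Ω → ℕ) (_ : Measurable mhat)
        (_ : ∀ ω, FunLin.IsSelected (fun i => X i ω) (fun i => FunLin.response K X ε i ω)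
          (φ (fun i => X i ω)) δ σsq N (mhat ω)),
        Integrable (fun ω => FunLin.empNormSq (fun i => X i ω)
          (FunLin.integralOp K - FunLin.slopeEst (fun i => X i ω)
            (fun i => FunLin.response K X ε i ω) (φ (fun i => X i ω)) (mhat ω))) P ∧
        (∀ m ∈ Set.Icc 1 N, Integrable (fun ω => FunLin.empNormSq (fun i => X i ω)
          (FunLin.integralOp K - FunLin.projOp (φ (fun i => X i ω)) m K)) P) ∧
        ∫ ω, FunLin.empNormSq (fun i => X i ω)
            (FunLin.integralOp K - FunLin.slopeEst (fun i => X i ω)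
              (fun i => FunLin.response K X ε i ω) (φ (fun i => X i ω)) (mhat ω)) ∂P ≤
          (1 + ζ) * (⨅ m : Set.Icc 1 N,
            (∫ ω, FunLin.empNormSq (fun i => X i ω)
                (FunLin.integralOp K - FunLin.projOp (φ (fun i => X i ω)) m K) ∂P +
              (2 + ζ) / (1 + ζ) * FunLin.pen n δ σsq m)) + C' / n := by
  -- The value of `η` for which `(1 + η) / (1 - η) = 1 + ζ`.
  set η : ℝ := ζ / (2 + ζ) with hη
  have hη0 : 0 < η := by positivity
  set B : ℝ := FunLin.excessBound σsq (1 + τ) (8 * δ) η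
  -- The summand `1` only serves to make the constant positive.
  refine ⟨(2 + ζ) / 2 * |B| + 1, by positivity, ?_⟩
  intro Ω _ P _ n N hn hN _ K X ε hD hpi hpτ φ hφ hφm mhat hmm hsel
  have hn0 : (0 : ℝ) < n := by exact_mod_cast hn
  have hnoise := hD.isNoise hp hpi hpτ
  have hσ := hnoise.variance_nonneg ⟨0, hn⟩
  refine ⟨hD.integrable_empNormSq_sub_slopeEst hn hφ hφm K hmm,
    fun m _ => hD.integrable_empNormSq_sub_projOp hn hφ hφm K m, ?_⟩
  have : Nonempty (Set.Icc 1 N) := ⟨⟨1, le_rfl, hN⟩⟩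
  rw [← sub_le_iff_le_add, ← div_le_iff₀' (by positivity)]
  refine le_ciInf fun ⟨m, hm⟩ => ?_
  rw [div_le_iff₀' (by positivity)]
  have key := hD.integral_empNormSq_le hn hnoise hφ hφm K hmm hδ hη0 hm hsel
  have hpen : 0 ≤ FunLin.pen n δ σsq m := by unfold FunLin.pen; positivity
  have hB : B / n ≤ |B| / n := by
    gcongr
    exact le_abs_self B
  have e1 : 1 - η = 2 / (2 + ζ) := by rw [hη]; field_simp; ring
  have e2 : 1 + η = 2 * (1 + ζ) / (2 + ζ) := by rw [hη]; field_simp; ring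
  have e3 : ((2 + ζ) / 2 * |B| + 1) / n = (2 + ζ) / 2 * (|B| / n) + 1 / n := by ring
  have e4 : 0 < 1 / (n : ℝ) := by positivity
  generalize (∫ ω, FunLin.empNormSq (fun i => X i ω) (FunLin.integralOp K -
    FunLin.slopeEst (fun i => X i ω) (fun i => FunLin.response K X ε i ω)
      (φ fun i => X i ω) (mhat ω)) ∂P) = L at key ⊢
  generalize (∫ ω, FunLin.empNormSq (fun i => X i ω) (FunLin.integralOp K -
    FunLin.projOp (φ fun i => X i ω) m K) ∂P) = b at key ⊢
  have h1 := (key.trans (add_le_add_right hB _))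
  have h2 := mul_le_mul_of_nonneg_left h1 (by positivity : 0 ≤ (2 + ζ) / 2)
  have h3 : (2 + ζ) / 2 * ((1 - η) * L) = L := by rw [e1]; field_simp
  have h4 : (2 + ζ) / 2 * ((1 + η) * b) = (1 + ζ) * b := by rw [e2]; field_simp
  have h5 : (1 + ζ) * (b + (2 + ζ) / (1 + ζ) * FunLin.pen n δ σsq m) =
      (1 + ζ) * b + (2 + ζ) * FunLin.pen n δ σsq m := by field_simp
  have h6 : 0 ≤ (2 + ζ) / 2 * FunLin.pen n δ σsq m := by positivity
  rw [h3, mul_add, mul_add, h4] at h2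
  rw [h5, e3]
  linarith
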